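/- Let $K$ be a quadratic field with nontrivial automorphism $\sigma$ and let $\overline{\mathbb Q}$ be an algebraic closure of $K$. For coprime positive integers $d,m$ and $n=dm$, a noncuspidal $\overline{\mathbb Q}$-point of $X_0(n)$ is an isomorphism class of triples $x=(E,C_d,C_m)$, where $E$ is an elliptic curve over $\overline{\mathbb Q}$ and $C_d,C_m\subset E$ are cyclic subgroups of orders $d$ and $m$; equivalently, of pairs $(E,C)$ with $C=C_d\oplus C_m$ cyclic of order $n$. The Atkin–Lehner involution is $w_d(x)=(\mu(E),\mu(E[d]),\mu(C_m))$, where $\mu$ is an isogeny from $E$ with kernel $C_d$. A noncuspidal rational point of $X_0(n)/w_d$ is a pair $\{x,w_d(x)\}$ stable under $\operatorname{Gal}(\overline{\mathbb Q}/\mathbb Q)$, and an elliptic curve $F$ over $K$ corresponds to this point if $j(F)$ is the $j$-invariant of the elliptic curve of $x$ or of $w_d(x)$. Write $X_0^+(n)=X_0(n)/w_n$. Let $d$ be an odd positive integer and let $E$ be an elliptic curve over $K$ without complex multiplication (over $\overline{\mathbb Q}$). Suppose that $E$ is a $\mathbb Q$-curve of degree $d$, i.e. there is an isogeny $E\to E^\sigma$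 over $\overline{\mathbb Q}$ whose kernel is cyclic of order $d$, and that $E$ has a $4$-isogeny defined over $K$, i.e. there are an elliptic curve $E'$ over $K$ and an isogeny $E\to E'$ defined over $K$ whose kernel is isomorphic to $\mathbb Z/4\mathbb Z$. Then $E$, or an elliptic curve over $K$ that is isogenous to $E$ over $K$, corresponds to a noncuspidal rational point on $X_0^+(4d)$, $X_0^+(16d)$ or $X_0(4d)/w_d$. -/

import Mathlib

namespace QuadQCurve

open WeierstrassCurve

section Isogenies

variable {L : Type*} [Field L] [DecidableEq L]

/-- Let `k` be a subfield of an algebraically closed field `L` of characteristic zero and let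
`W`, `W'` be elliptic curves over `k`, viewed over `L`. A group homomorphism `φ : W(L) → W'(L)`
is an isogeny defined over `k` if it is a rational map with coefficients in `k`: outside a finite
set of points, `φ (x, y) = (a(x, y) / c(x, y), b(x, y) / c(x, y))` for fixed polynomials
`a`, `b`, `c` over `k`. Such a `φ` is nonzero because `W(L)` is infinite and only finitely many
points may be sent to the origin. -/
def IsIsogeny (k : Type*) [Field k] [Algebra k L] {W W' : WeierstrassCurve L}
    (φ : W.toAffine.Point →+ W'.toAffine.Point) : Prop :=
  ∃ a b c : MvPolynomial (Fin 2) k,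
    {P : W.toAffine.Point | ¬ ∃ (x y : L) (h : W.toAffine.Nonsingular x y)
        (u v : L) (h' : W'.toAffine.Nonsingular u v),
        P = .some x y h ∧ φ P = .some u v h' ∧
        MvPolynomial.aeval ![x, y] c ≠ 0 ∧
        u = MvPolynomial.aeval ![x, y] a / MvPolynomial.aeval ![x, y] c ∧
        v = MvPolynomial.aeval ![x, y] b / MvPolynomial.aeval ![x, y] c}.Finite

/-- The kernel of `φ` is cyclic of order `n`. For isogenies in characteristic zero the order of
the kernel is the degree, so these are the cyclic isogenies of degree `n`, or `n`-isogenies. -/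
def HasCyclicKernel {W W' : WeierstrassCurve L}
    (φ : W.toAffine.Point →+ W'.toAffine.Point) (n : ℕ) : Prop :=
  IsAddCyclic φ.ker ∧ Nat.card φ.ker = n

end Isogenies

section OverAField

variable {K : Type*} [Field K] (L : Type*) [Field L] [DecidableEq L] [Algebra K L]

/-- `E` and `F` are isogenous over `K`. -/
def IsogenousOver (E F : WeierstrassCurve K) : Prop :=
  ∃ φ : (E.baseChange L).toAffine.Point →+ (F.baseChange L).toAffine.Point, IsIsogeny K φ

/-- `E` has an `n`-isogeny defined over `K`: there are an elliptic curve `E'` over `K` and an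
isogeny `E → E'` defined over `K` whose kernel is cyclic of order `n`. -/
def HasCyclicIsogeny (E : WeierstrassCurve K) (n : ℕ) : Prop :=
  ∃ E' : WeierstrassCurve K, E'.IsElliptic ∧
    ∃ φ : (E.baseChange L).toAffine.Point →+ (E'.baseChange L).toAffine.Point,
      IsIsogeny K φ ∧ HasCyclicKernel φ n

/-- `E` does not have complex multiplication: every isogeny `E → E` over the algebraic closure
`L` is multiplication by an integer. -/
def IsNonCM (E : WeierstrassCurve K) : Prop :=
  ∀ φ : (E.baseChange L).toAffine.Point →+ (E.baseChange L).toAffine.Point,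
    IsIsogeny L φ → ∃ n : ℤ, ∀ P, φ P = n • P

/-- For a quadratic field `K` with algebraic closure `L`: `E` is a `ℚ`-curve of degree `d`, that
is, with `σ` the nontrivial automorphism of `K`, there is a cyclic isogeny `E → E^σ` of degree
`d` over `L`. -/
def IsQCurveOfDegree [CharZero K] (E : WeierstrassCurve K) (d : ℕ) : Prop :=
  ∃ σ : K ≃ₐ[ℚ] K, σ ≠ 1 ∧
    ∃ μ : (E.baseChange L).toAffine.Point →+
        ((E.map (σ : K →+* K)).baseChange L).toAffine.Point,
      IsIsogeny L μ ∧ HasCyclicKernel μ d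

end OverAField

section ModularCurves

variable {L : Type*} [Field L] [DecidableEq L]

/-- The conjugation homomorphism `W(L) → W^τ(L)`, `(x, y) ↦ (τ x, τ y)`. -/
def conjPoint (τ : L →+* L) (W : WeierstrassCurve L) :
    W.toAffine.Point →+ (W.map τ).toAffine.Point where
  toFun P := match P with
    | .zero => .zero
    | .some x y h =>
        .some (τ x) (τ y) ((Affine.map_nonsingular W.toAffine τ.injective x y).mpr h)
  map_zero' := rfl
  map_add' := by
    rintro (_ | ⟨x₁, y₁, h₁⟩) (_ | ⟨x₂, y₂, h₂⟩)
    any_goals rfl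
    by_cases hxy : x₁ = x₂ ∧ y₁ = W.toAffine.negY x₂ y₂
    · rw [Affine.Point.add_of_Y_eq hxy.left hxy.right,
        Affine.Point.add_of_Y_eq (congr_arg _ hxy.left) <| by rw [hxy.right, Affine.map_negY]]
      rfl
    · simpa only [Affine.Point.add_some hxy, ← Affine.map_addX, ← Affine.map_addY,
        ← Affine.map_slope] using!
        (Affine.Point.add_some fun h ↦
          hxy ⟨τ.injective h.1, τ.injective (Affine.map_negY (W' := W.toAffine) τ .. ▸ h).2⟩).symm

variable (L) in
/-- A pair `(E, C)` of an elliptic curve over `L` and a cyclic subgroup of order `n`. For `L`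
algebraically closed, the `L`-points of `Y₀(n)`, that is, the noncuspidal `L`-points of `X₀(n)`,
are the isomorphism classes of such pairs. -/
structure LevelPair (n : ℕ) where
  curve : WeierstrassCurve L
  isElliptic : curve.IsElliptic
  subgroup : AddSubgroup curve.toAffine.Point
  isCyclic : IsAddCyclic subgroup
  card_eq : Nat.card subgroup = n

attribute [instance] LevelPair.isElliptic

namespace LevelPair

variable {n : ℕ}

/-- `(E, C)` and `(E', C')` are isomorphic, so they define the same point of `Y₀(n)`. -/
def Iso (x y : LevelPair L n) : Prop :=
  ∃ e : x.curve.toAffine.Point ≃+ y.curve.toAffine.Point,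
    IsIsogeny L e.toAddMonoidHom ∧ IsIsogeny L e.symm.toAddMonoidHom ∧
      x.subgroup.map e.toAddMonoidHom = y.subgroup

/-- `conjPoint` is injective. -/
lemma conjPoint_injective (τ : L →+* L) (W : WeierstrassCurve L) :
    Function.Injective (conjPoint τ W) := by
  rintro (_ | ⟨x₁, y₁, h₁⟩) (_ | ⟨x₂, y₂, h₂⟩) h
  · rfl
  · cases h
  · cases h
  · have h' := Affine.Point.some.inj h
    simpa only [Affine.Point.some.injEq] using ⟨τ.injective h'.1, τ.injective h'.2⟩

/-- The Galois conjugate `(E^τ, τ(C))` of `(E, C)`. -/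
def conj (τ : L →+* L) (x : LevelPair L n) : LevelPair L n where
  curve := x.curve.map τ
  isElliptic := inferInstance
  subgroup := x.subgroup.map (conjPoint τ x.curve)
  isCyclic := by
    have := x.isCyclic
    exact isAddCyclic_of_surjective
      (x.subgroup.equivMapOfInjective _ (conjPoint_injective τ x.curve))
      (AddEquiv.surjective _)
  card_eq := (Nat.card_congr
    (x.subgroup.equivMapOfInjective _ (conjPoint_injective τ x.curve)).toEquiv).symm.trans x.card_eq

/-- For `d ∣ n` with `gcd (d, n / d) = 1`: the pair `y` represents the image `w_d(x)` of `x` under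
the Atkin–Lehner involution `w_d`. Writing `x = (E, C)` and `C = C_d ⊕ C_m` with `m = n / d`,
`C_d = C ∩ E[d]`, `C_m = C ∩ E[m]`, this means that there is an isogeny `μ` from `E` to the curve
of `y` with kernel `C_d` such that the subgroup of `y` is `μ(E[d]) + μ(C_m)`. -/
def IsAtkinLehnerImage (d : ℕ) (x y : LevelPair L n) : Prop :=
  ∃ μ : x.curve.toAffine.Point →+ y.curve.toAffine.Point,
    IsIsogeny L μ ∧
    μ.ker = x.subgroup ⊓ AddSubgroup.torsionBy x.curve.toAffine.Point (d : ℤ) ∧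
    y.subgroup =
      (AddSubgroup.torsionBy x.curve.toAffine.Point (d : ℤ)).map μ ⊔
        (x.subgroup ⊓ AddSubgroup.torsionBy x.curve.toAffine.Point ((n / d : ℕ) : ℤ)).map μ

/-- For `L` an algebraic closure of `ℚ`: the image of `x` in `X₀(n)/w_d` is a `ℚ`-rational point,
that is, the orbit `{x, w_d(x)}` is stable under `Gal(L/ℚ)`: every conjugate of `x` is
`x` or `w_d(x)` as a point of `Y₀(n)`. -/
def IsRationalModAtkinLehner [CharZero L] (d : ℕ) (x : LevelPair L n) : Prop :=
  ∀ τ : L ≃ₐ[ℚ] L,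
    (x.conj (τ : L →+* L)).Iso x ∨ x.IsAtkinLehnerImage d (x.conj (τ : L →+* L))

end LevelPair

variable {K : Type*} [Field K] (L) [CharZero L] [Algebra K L]

/-- The elliptic curve `F` corresponds to a (noncuspidal) `ℚ`-rational point of `X₀(n)/w_d`:
there is such a point, the class of `{x, w_d(x)}`, for which `j(F)` is the `j`-invariant of the
curve of `x` or of the curve of `w_d(x)`. -/
def CorrespondsToRationalPoint (F : WeierstrassCurve K) [F.IsElliptic] (n d : ℕ) : Prop :=
  ∃ x : LevelPair L n, x.IsRationalModAtkinLehner d ∧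
    (algebraMap K L F.j = x.curve.j ∨
      ∃ y : LevelPair L n, x.IsAtkinLehnerImage d y ∧ algebraMap K L F.j = y.curve.j)

/-- The same for the curve `X₀⁺(n) = X₀(n)/w_n`. -/
def CorrespondsToRationalPointPlus (F : WeierstrassCurve K) [F.IsElliptic] (n : ℕ) : Prop :=
  CorrespondsToRationalPoint L F n n

end ModularCurves

end QuadQCurve

/-!
Let `μ : E → E^σ` be the given isogeny, of degree `d`, let `φ : E → E'` be an isogeny over `K` with
cyclic kernel of order `n` prime to `d`, and lift a generator of `ker φ^σ` through `μ` to a point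
`e` of order `n`. Let `m` be the order of `φ e`. If `m = 1`, then `μ` maps `ker φ` to `ker φ^σ`, and
`(E, ker μ + ker φ)` gives a rational point of `X₀(nd)/w_d`. Otherwise `m` is the least positive
integer for which `φ^σ ∘ μ ∘ [m]` kills `ker φ`; it then factors as `ψ ∘ φ` with `ψ : E' → E'^σ`
cyclic of degree `m² d`, and `(E', ker ψ)` gives a rational point of `X₀⁺(m² d)`. For `n = 4` this
leaves `m = 2` and `m = 4`.

Rationality comes from the absence of complex multiplication: isogenies `E → E^σ` of the same degree
agree up to sign, so that `Gal(L/K)` fixes `ker μ`, and if `τ` restricts to `σ`, then `μ^τ ∘ μ` is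
multiplication by `± d`, so that `ker μ^τ = μ(E[d])`.

Isogenies are only given as rational maps away from finitely many points, hence the basic facts on
them (surjectivity, factorization through the kernel, sums) are derived from the field of rational
functions in `x` and `2y + a₁x + a₃`, in which the even functions are those of `x` alone. The order
of `E[n]` follows from the parallelogram law for degrees.
-/

namespace QuadQCurve

open WeierstrassCurve Polynomial Filter

/-! ### Coordinates of points -/

lemma eventually_forall_of_map_eq {α β : Type*} {p : α → Prop} (h : ∀ᶠ a in cofinite, p a)
    (f : α → β) : ∀ᶠ b in cofinite, ∀ a, f a = b → p a := by
  rw [eventually_cofinite] at h ⊢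
  refine (h.image f).subset fun b hb => ?_
  simp only [Set.mem_ofPred_eq, not_forall] at hb
  obtain ⟨a, hab, ha⟩ := hb
  exact ⟨a, ha, hab⟩

section Coordinates

variable {L : Type*} [Field L] {W : WeierstrassCurve L}

/-- The `x`-coordinate of a point, with the junk value `0` at the origin. -/
def xCoord : W.toAffine.Point → L
  | .zero => 0
  | .some x _ _ => x

/-- The `y`-coordinate of a point, with the junk value `0` at the origin. -/
def yCoord : W.toAffine.Point → L
  | .zero => 0
  | .some _ y _ => y

/-- The coordinate `2 y + a₁ x + a₃` of a point, with value `0` at the origin. Unlike `y` it is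
odd, and its square is a polynomial in `x`. -/
def oddCoord : W.toAffine.Point → L
  | .zero => 0
  | .some x y _ => 2 * y + W.a₁ * x + W.a₃

@[simp] lemma xCoord_some {x y : L} (h : W.toAffine.Nonsingular x y) :
    xCoord (Affine.Point.some x y h) = x := rfl

@[simp] lemma oddCoord_some {x y : L} (h : W.toAffine.Nonsingular x y) :
    oddCoord (Affine.Point.some x y h) = 2 * y + W.a₁ * x + W.a₃ := rfl

lemma exists_eq_some {P : W.toAffine.Point} (hP : P ≠ 0) :
    ∃ h : W.toAffine.Nonsingular (xCoord P) (yCoord P), P = .some (xCoord P) (yCoord P) h := by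
  match P, hP with
  | .zero, hP => exact absurd rfl hP
  | .some x y h, _ => exact ⟨h, rfl⟩

lemma eq_of_xCoord_eq_of_yCoord_eq {P Q : W.toAffine.Point} (hP : P ≠ 0) (hQ : Q ≠ 0)
    (hx : xCoord P = xCoord Q) (hy : yCoord P = yCoord Q) : P = Q := by
  obtain ⟨h, hP⟩ := exists_eq_some hP
  obtain ⟨h', hQ⟩ := exists_eq_some hQ
  rw [hP, hQ, Affine.Point.some.injEq]
  exact ⟨hx, hy⟩

lemma oddCoord_eq {P : W.toAffine.Point} (hP : P ≠ 0) :
    oddCoord P = 2 * yCoord P + W.a₁ * xCoord P + W.a₃ := by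
  obtain ⟨h, hP⟩ := exists_eq_some hP
  rw [hP]
  rfl

@[simp] lemma xCoord_neg (P : W.toAffine.Point) : xCoord (-P) = xCoord P := by
  match P with
  | .zero => rfl
  | .some x y h => rfl

@[simp] lemma oddCoord_neg (P : W.toAffine.Point) : oddCoord (-P) = -oddCoord P := by
  match P with
  | .zero => exact neg_zero.symm
  | .some x y h =>
    rw [Affine.Point.neg_some, oddCoord_some, oddCoord_some, Affine.negY]
    ring

lemma eq_or_eq_neg_of_xCoord_eq {P Q : W.toAffine.Point} (hP : P ≠ 0) (hQ : Q ≠ 0)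
    (h : xCoord P = xCoord Q) : P = Q ∨ P = -Q := by
  match P, Q, hP, hQ with
  | .zero, _, hP, _ => exact absurd rfl hP
  | _, .zero, _, hQ => exact absurd rfl hQ
  | .some _ _ _, .some _ _ _, _, _ => exact Affine.Point.X_eq_iff.mp h

lemma oddCoord_sq {P : W.toAffine.Point} (hP : P ≠ 0) :
    oddCoord P ^ 2 = W.Ψ₂Sq.eval (xCoord P) := by
  obtain ⟨h, hP⟩ := exists_eq_some hP
  have h_eq := (Affine.equation_iff ..).mp h.left
  rw [hP]
  simp only [oddCoord_some, xCoord_some, Ψ₂Sq, b₂, b₄, b₆, eval_add, eval_mul, eval_C, eval_pow,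
    eval_X]
  linear_combination 4 * h_eq

lemma oddCoord_eq_zero_iff {P : W.toAffine.Point} : oddCoord P = 0 ↔ P = -P := by
  match P with
  | .zero => exact ⟨fun _ => rfl, fun _ => rfl⟩
  | .some x y h =>
    rw [Affine.Point.neg_some, oddCoord_some, Affine.Point.some.injEq, Affine.negY]
    constructor
    · intro h
      exact ⟨rfl, by linear_combination h⟩
    · rintro ⟨-, h⟩
      linear_combination h

lemma exists_xCoord_eq [IsAlgClosed L] [W.IsElliptic] (x : L) :
    ∃ P : W.toAffine.Point, P ≠ 0 ∧ xCoord P = x := by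
  obtain ⟨y, hy⟩ := IsAlgClosed.exists_root
    (X ^ 2 + C (W.a₁ * x + W.a₃) * X - C (x ^ 3 + W.a₂ * x ^ 2 + W.a₄ * x + W.a₆) : L[X])
    (by rw [show degree _ = 2 by compute_degree!]; decide)
  have h : W.toAffine.Equation x y := by
    rw [Affine.equation_iff]
    simp only [IsRoot.def, eval_sub, eval_add, eval_mul, eval_pow, eval_X, eval_C] at hy
    linear_combination hy
  exact ⟨.some x y (Affine.equation_iff_nonsingular.mp h), Affine.Point.some_ne_zero _, rfl⟩

lemma finite_xCoord_fibre (c : L) : (xCoord ⁻¹' {c} : Set W.toAffine.Point).Finite := by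
  by_cases h : ∃ Q : W.toAffine.Point, Q ≠ 0 ∧ xCoord Q = c
  · obtain ⟨Q, hQ, rfl⟩ := h
    refine (Set.toFinite {0, Q, -Q}).subset fun P hP => ?_
    by_cases hP0 : P = 0
    · exact Or.inl hP0
    · exact Or.inr (eq_or_eq_neg_of_xCoord_eq hP0 hQ hP)
  · push Not at h
    refine (Set.finite_singleton 0).subset fun P hP => ?_
    by_contra h0
    exact h P h0 hP

lemma tendsto_xCoord : Tendsto (xCoord : W.toAffine.Point → L) cofinite cofinite :=
  Tendsto.cofinite_of_finite_preimage_singleton finite_xCoord_fibre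

lemma eventually_eval_ne_zero {p : L[X]} (hp : p ≠ 0) : ∀ᶠ x in cofinite, p.eval x ≠ 0 := by
  rw [eventually_cofinite]
  simpa only [not_not] using! Polynomial.finite_setOfPred_isRoot hp

lemma eventually_eval_xCoord_ne_zero {p : L[X]} (hp : p ≠ 0) :
    ∀ᶠ P : W.toAffine.Point in cofinite, p.eval (xCoord P) ≠ 0 :=
  tendsto_xCoord.eventually (eventually_eval_ne_zero hp)

lemma eventually_ne_zero : ∀ᶠ P : W.toAffine.Point in cofinite, P ≠ 0 :=
  (Set.finite_singleton 0).eventually_cofinite_notMem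

lemma tendsto_neg : Tendsto (fun P : W.toAffine.Point => -P) cofinite cofinite :=
  neg_injective.tendsto_cofinite

variable (W) in
lemma infinite_point [IsAlgClosed L] [W.IsElliptic] : Infinite W.toAffine.Point :=
  have : Infinite L := IsAlgClosed.instInfinite
  Infinite.of_surjective (xCoord : W.toAffine.Point → L) fun x =>
    (exists_xCoord_eq x).imp fun _ h => h.2

end Coordinates

/-! ### Rational functions -/

section RationalFunctions

variable {L : Type*} [Field L] {W : WeierstrassCurve L}

/-- A function on the points of `W` is rational if outside a finite set it is given by an element
of the function field `L(x, y)`, written here in the form `(α(x) + β(x) ω) / γ(x)` with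
`ω = 2 y + a₁ x + a₃`. -/
def IsRatFun (f : W.toAffine.Point → L) : Prop :=
  ∃ α β γ : L[X], γ ≠ 0 ∧ ∀ᶠ P in cofinite,
    f P = (α.eval (xCoord P) + β.eval (xCoord P) * oddCoord P) / γ.eval (xCoord P)

section Norm

variable [CharZero L]

variable (W) in
/-- The degree of `Ψ₂Sq` is odd, so it is not a square in `L(x)`. -/
lemma sq_sub_sq_mul_Ψ₂Sq_ne_zero {α β : L[X]} (h : α ≠ 0 ∨ β ≠ 0) :
    α ^ 2 - β ^ 2 * W.Ψ₂Sq ≠ 0 := by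
  have h4 : (4 : L) ≠ 0 := by norm_num
  intro h0
  have hsq : α ^ 2 = β ^ 2 * W.Ψ₂Sq := sub_eq_zero.mp h0
  have hβ : β ≠ 0 := by
    rintro rfl
    exact h.elim (fun hα => hα (by simpa using hsq)) (fun h => h rfl)
  have hdeg := congrArg natDegree hsq
  rw [natDegree_mul (pow_ne_zero 2 hβ) (W.Ψ₂Sq_ne_zero h4), natDegree_pow, natDegree_pow,
    W.natDegree_Ψ₂Sq h4] at hdeg
  omega

lemma eventually_add_mul_oddCoord_ne_zero {α β : L[X]} (h : α ≠ 0 ∨ β ≠ 0) :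
    ∀ᶠ P : W.toAffine.Point in cofinite,
      α.eval (xCoord P) + β.eval (xCoord P) * oddCoord P ≠ 0 := by
  filter_upwards [eventually_eval_xCoord_ne_zero (sq_sub_sq_mul_Ψ₂Sq_ne_zero W h),
    eventually_ne_zero] with P hnorm hP h0
  apply hnorm
  simp only [eval_sub, eval_mul, eval_pow, ← oddCoord_sq hP]
  linear_combination (α.eval (xCoord P) - β.eval (xCoord P) * oddCoord P) * h0

lemma eventually_oddCoord_ne_zero : ∀ᶠ P : W.toAffine.Point in cofinite, oddCoord P ≠ 0 := by
  simpa using eventually_add_mul_oddCoord_ne_zero (α := (0 : L[X])) (Or.inr one_ne_zero)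

end Norm

namespace IsRatFun

variable {f g : W.toAffine.Point → L}

lemma congr (hf : IsRatFun f) (h : ∀ᶠ P in cofinite, g P = f P) : IsRatFun g := by
  obtain ⟨α, β, γ, hγ, hf⟩ := hf
  exact ⟨α, β, γ, hγ, h.mp (hf.mono fun P hf h => h.trans hf)⟩

lemma const (c : L) : IsRatFun fun _ : W.toAffine.Point => c :=
  ⟨C c, 0, 1, one_ne_zero, .of_forall fun P => by simp⟩

protected lemma xCoord : IsRatFun (xCoord : W.toAffine.Point → L) :=
  ⟨X, 0, 1, one_ne_zero, .of_forall fun P => by simp⟩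

protected lemma oddCoord : IsRatFun (oddCoord : W.toAffine.Point → L) :=
  ⟨0, 1, 1, one_ne_zero, .of_forall fun P => by simp⟩

lemma add (hf : IsRatFun f) (hg : IsRatFun g) : IsRatFun fun P => f P + g P := by
  obtain ⟨α, β, γ, hγ, hf⟩ := hf
  obtain ⟨α', β', γ', hγ', hg⟩ := hg
  refine ⟨α * γ' + α' * γ, β * γ' + β' * γ, γ * γ', mul_ne_zero hγ hγ', ?_⟩
  filter_upwards [hf, hg, eventually_eval_xCoord_ne_zero hγ, eventually_eval_xCoord_ne_zero hγ']
    with P hf hg hγ hγ'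
  rw [hf, hg, div_add_div _ _ hγ hγ']
  simp only [eval_add, eval_mul]
  ring

lemma mul (hf : IsRatFun f) (hg : IsRatFun g) : IsRatFun fun P => f P * g P := by
  obtain ⟨α, β, γ, hγ, hf⟩ := hf
  obtain ⟨α', β', γ', hγ', hg⟩ := hg
  refine ⟨α * α' + β * β' * W.Ψ₂Sq, α * β' + β * α', γ * γ', mul_ne_zero hγ hγ', ?_⟩
  filter_upwards [hf, hg, eventually_ne_zero] with P hf hg hP
  rw [hf, hg, div_mul_div_comm]
  simp only [eval_add, eval_mul, ← oddCoord_sq hP]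
  ring

lemma neg (hf : IsRatFun f) : IsRatFun fun P => -f P :=
  ((const (-1)).mul hf).congr (.of_forall fun P => by ring)

lemma sub (hf : IsRatFun f) (hg : IsRatFun g) : IsRatFun fun P => f P - g P :=
  (hf.add hg.neg).congr (.of_forall fun P => by ring)

lemma pow (hf : IsRatFun f) (n : ℕ) : IsRatFun fun P => f P ^ n := by
  induction n with
  | zero => simpa only [pow_zero] using const 1
  | succ n ih => simpa only [pow_succ] using! ih.mul hf

lemma eval (hf : IsRatFun f) (p : L[X]) : IsRatFun fun P => p.eval (f P) := by
  induction p using Polynomial.induction_on' with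
  | add p q hp hq => simpa only [eval_add] using! hp.add hq
  | monomial n a => simpa only [eval_monomial] using! (const a).mul (hf.pow n)

lemma aeval (hf : IsRatFun f) (hg : IsRatFun g) (p : MvPolynomial (Fin 2) L) :
    IsRatFun fun P => MvPolynomial.aeval ![f P, g P] p := by
  induction p using MvPolynomial.induction_on with
  | C a => simpa only [MvPolynomial.aeval_C] using! const a
  | add p q hp hq => simpa only [map_add] using! hp.add hq
  | mul_X p i hp =>
    simp only [map_mul, MvPolynomial.aeval_X]
    refine hp.mul ?_
    fin_cases i
    · exact hf
    · exact hg

variable [CharZero L]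

lemma inv (hf : IsRatFun f) : IsRatFun fun P => (f P)⁻¹ := by
  obtain ⟨α, β, γ, -, hf⟩ := hf
  by_cases h : α ≠ 0 ∨ β ≠ 0
  · have hnorm := sq_sub_sq_mul_Ψ₂Sq_ne_zero W h
    refine ⟨γ * α, -γ * β, α ^ 2 - β ^ 2 * W.Ψ₂Sq, hnorm, ?_⟩
    filter_upwards [hf, eventually_eval_xCoord_ne_zero hnorm, eventually_ne_zero,
      eventually_add_mul_oddCoord_ne_zero h] with P hf hnorm hP hnum
    rw [hf, inv_div, div_eq_div_iff hnum hnorm]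
    simp only [eval_sub, eval_mul, eval_pow, eval_neg, ← oddCoord_sq hP]
    ring
  · push Not at h
    refine (const 0).congr (hf.mono fun P hf => ?_)
    rw [hf, h.1, h.2]
    simp

lemma div (hf : IsRatFun f) (hg : IsRatFun g) : IsRatFun fun P => f P / g P := by
  simpa only [div_eq_mul_inv] using! hf.mul hg.inv

protected lemma yCoord : IsRatFun (yCoord : W.toAffine.Point → L) := by
  refine ((const 2⁻¹).mul
    ((IsRatFun.oddCoord.sub ((const W.a₁).mul IsRatFun.xCoord)).sub (const W.a₃))).congr ?_
  filter_upwards [eventually_ne_zero] with P hP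
  rw [oddCoord_eq hP]
  field_simp
  ring

lemma eventually_eq_zero_or_eventually_ne_zero (hf : IsRatFun f) :
    (∀ᶠ P in cofinite, f P = 0) ∨ ∀ᶠ P in cofinite, f P ≠ 0 := by
  obtain ⟨α, β, γ, hγ, hf⟩ := hf
  by_cases h : α ≠ 0 ∨ β ≠ 0
  · right
    filter_upwards [hf, eventually_eval_xCoord_ne_zero hγ, eventually_add_mul_oddCoord_ne_zero h]
      with P hf hγ hnum
    rw [hf]
    exact div_ne_zero hnum hγ
  · left
    push Not at h
    refine hf.mono fun P hf => ?_
    rw [hf, h.1, h.2]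
    simp

lemma exists_eval_div_eval_of_even (hf : IsRatFun f) (heven : ∀ P, f (-P) = f P) :
    ∃ α γ : L[X], γ ≠ 0 ∧ ∀ᶠ P in cofinite, f P = α.eval (xCoord P) / γ.eval (xCoord P) := by
  obtain ⟨α, β, γ, hγ, hf⟩ := hf
  refine ⟨α, γ, hγ, ?_⟩
  filter_upwards [hf, tendsto_neg.eventually hf] with P hP hnegP
  rw [heven, xCoord_neg, oddCoord_neg] at hnegP
  apply mul_left_cancel₀ (two_ne_zero (α := L))
  nth_rw 1 [two_mul, hP, hnegP, ← add_div]
  ring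

end IsRatFun

end RationalFunctions

/-! ### Homomorphisms with finite kernel -/

section Homs

variable {A B : Type*} [AddCommGroup A] [AddCommGroup B]

lemma eq_top_of_eventually_mem [Infinite A] {H : AddSubgroup A}
    (h : ∀ᶠ a in cofinite, a ∈ H) : H = ⊤ := by
  refine (AddSubgroup.eq_top_iff' H).mpr fun a => ?_
  obtain ⟨b, hb, hab⟩ := (h.and ((add_right_injective a).tendsto_cofinite.eventually h)).exists
  simpa only [add_sub_cancel_right] using H.sub_mem hab hb

lemma hom_ext_of_eventually_eq [Infinite A] {f g : A →+ B}
    (h : ∀ᶠ a in cofinite, f a = g a) : f = g := by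
  have htop : f.eqLocus g = ⊤ := eq_top_of_eventually_mem h
  exact AddMonoidHom.eq_of_eqOn_top fun a _ => (htop ▸ AddSubgroup.mem_top a : a ∈ f.eqLocus g)

lemma tendsto_of_finite_ker {f : A →+ B} (h : (f.ker : Set A).Finite) :
    Tendsto f cofinite cofinite := by
  refine Tendsto.cofinite_of_finite_preimage_singleton fun b => ?_
  by_cases hb : ∃ a, f a = b
  · obtain ⟨a, rfl⟩ := hb
    refine (h.image (a + ·)).subset fun a' ha' => ⟨a' - a, ?_, by simp⟩
    have ha' : f a' = f a := ha'
    simp [AddMonoidHom.mem_ker, ha']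
  · exact Set.finite_empty.subset fun a ha => hb ⟨a, ha⟩

lemma card_ker_comp {C : Type*} [AddCommGroup C] (g : B →+ C) {f : A →+ B}
    (hf : Function.Surjective f) :
    Nat.card (g.comp f).ker = Nat.card f.ker * Nat.card g.ker := by
  have hle : f.ker ≤ g.ker.comap f := AddMonoidHom.ker_le_comap f g.ker
  rw [← AddMonoidHom.comap_ker, ← AddSubgroup.relIndex_bot_left (g.ker.comap f),
    ← AddSubgroup.relIndex_mul_relIndex _ _ _ bot_le hle, AddSubgroup.relIndex_bot_left,
    ← AddMonoidHom.comap_bot, AddSubgroup.relIndex_comap,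
    AddSubgroup.map_comap_eq_self_of_surjective hf, AddSubgroup.relIndex_bot_left]

end Homs

/-! ### Isogenies and rational functions -/

section Isogenies

variable {L : Type*} [Field L]

lemma aeval_aeval_X_zero (x y : L) (p : L[X]) :
    MvPolynomial.aeval ![x, y] (Polynomial.aeval (MvPolynomial.X 0 : MvPolynomial (Fin 2) L) p) =
      p.eval x := by
  rw [← Polynomial.aeval_algHom_apply, MvPolynomial.aeval_X, Matrix.cons_val_zero,
    Polynomial.coe_aeval_eq_eval]

variable [DecidableEq L] {W W' W'' : WeierstrassCurve L}

section GivenBy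

variable {k : Type*} [Field k] [Algebra k L] {φ ψ : W.toAffine.Point →+ W'.toAffine.Point}
  {a b c : MvPolynomial (Fin 2) k}

/-- Outside a finite set of points, `φ` is the map `(x, y) ↦ (a(x, y) / c(x, y), b(x, y) / c(x, y))`
between affine points. -/
def IsGivenBy (φ : W.toAffine.Point →+ W'.toAffine.Point) (a b c : MvPolynomial (Fin 2) k) :
    Prop :=
  ∀ᶠ P in cofinite, P ≠ 0 ∧ φ P ≠ 0 ∧ MvPolynomial.aeval ![xCoord P, yCoord P] c ≠ 0 ∧
    xCoord (φ P) = MvPolynomial.aeval ![xCoord P, yCoord P] a /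
      MvPolynomial.aeval ![xCoord P, yCoord P] c ∧
    yCoord (φ P) = MvPolynomial.aeval ![xCoord P, yCoord P] b /
      MvPolynomial.aeval ![xCoord P, yCoord P] c

lemma isIsogeny_iff_exists_isGivenBy :
    IsIsogeny k φ ↔ ∃ a b c : MvPolynomial (Fin 2) k, IsGivenBy φ a b c := by
  refine exists₃_congr fun a b c =>
    iff_of_eq (congrArg Set.Finite (Set.ext fun P => not_congr ?_))
  constructor
  · rintro ⟨x, y, h, u, v, h', rfl, hφ, hc, hu, hv⟩
    simp only [Set.mem_ofPred_eq, hφ]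
    exact ⟨Affine.Point.some_ne_zero _, Affine.Point.some_ne_zero _, hc, hu, hv⟩
  · rintro ⟨hP, hφP, hc, hx, hy⟩
    obtain ⟨h, hP⟩ := exists_eq_some hP
    obtain ⟨h', hφP⟩ := exists_eq_some hφP
    exact ⟨_, _, h, _, _, h', hP, hφP, hc, hx, hy⟩

lemma IsGivenBy.baseChange (h : IsGivenBy φ a b c) :
    IsGivenBy φ (a.map (algebraMap k L)) (b.map (algebraMap k L)) (c.map (algebraMap k L)) := by
  simpa only [IsGivenBy, MvPolynomial.aeval_map_algebraMap] using h

lemma IsGivenBy.unique [Infinite W.toAffine.Point] (hφ : IsGivenBy φ a b c)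
    (hψ : IsGivenBy ψ a b c) : φ = ψ := by
  refine hom_ext_of_eventually_eq ?_
  filter_upwards [hφ, hψ] with P ⟨_, hφ0, _, hφx, hφy⟩ ⟨_, hψ0, _, hψx, hψy⟩
  exact eq_of_xCoord_eq_of_yCoord_eq hφ0 hψ0 (hφx.trans hψx.symm) (hφy.trans hψy.symm)

end GivenBy

variable {φ : W.toAffine.Point →+ W'.toAffine.Point}

namespace IsIsogeny

lemma baseChange {k : Type*} [Field k] [Algebra k L] (h : IsIsogeny k φ) : IsIsogeny L φ := by
  obtain ⟨a, b, c, h⟩ := isIsogeny_iff_exists_isGivenBy.mp h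
  exact isIsogeny_iff_exists_isGivenBy.mpr ⟨_, _, _, h.baseChange⟩

lemma eventually_ne_zero (h : IsIsogeny L φ) : ∀ᶠ P in cofinite, φ P ≠ 0 := by
  obtain ⟨a, b, c, h⟩ := isIsogeny_iff_exists_isGivenBy.mp h
  exact h.mono fun P hP => hP.2.1

lemma ne_zero [Infinite W.toAffine.Point] (h : IsIsogeny L φ) : φ ≠ 0 := by
  rintro rfl
  obtain ⟨P, hP⟩ := h.eventually_ne_zero.exists
  exact hP rfl

lemma finite_ker (h : IsIsogeny L φ) : (φ.ker : Set W.toAffine.Point).Finite := by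
  have hne := h.eventually_ne_zero
  rw [eventually_cofinite] at hne
  simpa only [not_not] using! hne

lemma tendsto (h : IsIsogeny L φ) : Tendsto φ cofinite cofinite :=
  tendsto_of_finite_ker h.finite_ker

variable [CharZero L]

lemma isRatFun_xCoord (h : IsIsogeny L φ) : IsRatFun fun P => xCoord (φ P) := by
  obtain ⟨a, b, c, h⟩ := isIsogeny_iff_exists_isGivenBy.mp h
  exact ((IsRatFun.xCoord.aeval .yCoord a).div (IsRatFun.xCoord.aeval .yCoord c)).congr
    (h.mono fun P hP => hP.2.2.2.1)

lemma isRatFun_oddCoord (h : IsIsogeny L φ) : IsRatFun fun P => oddCoord (φ P) := by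
  have hx := h.isRatFun_xCoord
  obtain ⟨a, b, c, h⟩ := isIsogeny_iff_exists_isGivenBy.mp h
  have hy : IsRatFun fun P => yCoord (φ P) :=
    ((IsRatFun.xCoord.aeval .yCoord b).div (IsRatFun.xCoord.aeval .yCoord c)).congr
      (h.mono fun P hP => hP.2.2.2.2)
  refine (((IsRatFun.const 2).mul hy).add
    (((IsRatFun.const W'.a₁).mul hx).add (IsRatFun.const W'.a₃))).congr ?_
  filter_upwards [h] with P hP
  rw [oddCoord_eq hP.2.1, add_assoc]

end IsIsogeny

lemma isIsogeny_of_isRatFun_yCoord (h0 : ∀ᶠ P in cofinite, φ P ≠ 0)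
    (hx : IsRatFun fun P => xCoord (φ P)) (hy : IsRatFun fun P => yCoord (φ P)) :
    IsIsogeny L φ := by
  obtain ⟨α, β, γ, hγ, hx⟩ := hx
  obtain ⟨α', β', γ', hγ', hy⟩ := hy
  let ι : L[X] →ₐ[L] MvPolynomial (Fin 2) L := Polynomial.aeval (MvPolynomial.X 0)
  let ω : MvPolynomial (Fin 2) L :=
    2 * MvPolynomial.X 1 + MvPolynomial.C W.a₁ * MvPolynomial.X 0 + MvPolynomial.C W.a₃
  refine isIsogeny_iff_exists_isGivenBy.mpr
    ⟨(ι α + ι β * ω) * ι γ', (ι α' + ι β' * ω) * ι γ, ι γ * ι γ', ?_⟩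
  filter_upwards [eventually_ne_zero, h0, eventually_eval_xCoord_ne_zero hγ,
    eventually_eval_xCoord_ne_zero hγ', hx, hy] with P hP hφP hγ hγ' hx hy
  have hω : MvPolynomial.aeval ![xCoord P, yCoord P] ω = oddCoord P := by
    rw [oddCoord_eq hP]
    simp [ω]
  simp only [map_mul, map_add, ι, aeval_aeval_X_zero, hω]
  exact ⟨hP, hφP, mul_ne_zero hγ hγ', hx.trans (mul_div_mul_right _ _ hγ').symm,
    hy.trans (by rw [mul_comm (γ.eval _), mul_div_mul_right _ _ hγ])⟩

variable [CharZero L]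

lemma isIsogeny_of_isRatFun_oddCoord (h0 : ∀ᶠ P in cofinite, φ P ≠ 0)
    (hx : IsRatFun fun P => xCoord (φ P)) (hω : IsRatFun fun P => oddCoord (φ P)) :
    IsIsogeny L φ := by
  refine isIsogeny_of_isRatFun_yCoord h0 hx (((IsRatFun.const 2⁻¹).mul
    ((hω.sub ((IsRatFun.const W'.a₁).mul hx)).sub (IsRatFun.const W'.a₃))).congr ?_)
  filter_upwards [h0] with P hP
  rw [oddCoord_eq hP]
  field_simp
  ring

namespace IsIsogeny

lemma isRatFun_comp (h : IsIsogeny L φ) {f : W'.toAffine.Point → L} (hf : IsRatFun f) :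
    IsRatFun fun P => f (φ P) := by
  obtain ⟨α, β, γ, -, hf⟩ := hf
  exact (((h.isRatFun_xCoord.eval α).add ((h.isRatFun_xCoord.eval β).mul h.isRatFun_oddCoord)).div
    (h.isRatFun_xCoord.eval γ)).congr (h.tendsto.eventually hf)

lemma comp {ψ : W'.toAffine.Point →+ W''.toAffine.Point} (hψ : IsIsogeny L ψ)
    (h : IsIsogeny L φ) : IsIsogeny L (ψ.comp φ) :=
  isIsogeny_of_isRatFun_oddCoord (h.tendsto.eventually hψ.eventually_ne_zero)
    (h.isRatFun_comp hψ.isRatFun_xCoord) (h.isRatFun_comp hψ.isRatFun_oddCoord)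

end IsIsogeny

/-- In terms of `x`-coordinates, `φ` is the fraction `A / B` in lowest terms. -/
structure HasXCoordFormula (φ : W.toAffine.Point →+ W'.toAffine.Point) (A B : L[X]) : Prop where
  isCoprime : IsCoprime A B
  ne_zero : B ≠ 0
  eventually_eq : ∀ᶠ P in cofinite, xCoord (φ P) = A.eval (xCoord P) / B.eval (xCoord P)

lemma IsIsogeny.exists_hasXCoordFormula (h : IsIsogeny L φ) :
    ∃ A B : L[X], HasXCoordFormula φ A B := by
  obtain ⟨α, γ, hγ, hx⟩ :=
    h.isRatFun_xCoord.exists_eval_div_eval_of_even fun P => by rw [map_neg, xCoord_neg]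
  obtain ⟨A, B, hA, hB, hAB⟩ := extract_gcd α γ
  have hg : gcd α γ ≠ 0 := gcd_ne_zero_of_right hγ
  refine ⟨A, B, (gcd_isUnit_iff A B).mp hAB, fun h0 => hγ (by rw [hB, h0, mul_zero]), ?_⟩
  filter_upwards [hx, eventually_eval_xCoord_ne_zero hg] with P hx hg
  calc xCoord (φ P) = (gcd α γ * A).eval (xCoord P) / (gcd α γ * B).eval (xCoord P) := by
        rw [← hA, ← hB, hx]
    _ = A.eval (xCoord P) / B.eval (xCoord P) := by
        rw [eval_mul, eval_mul, mul_div_mul_left _ _ hg]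

end Isogenies

/-! ### Fibres of an isogeny -/

section RationalFunctionFibres

variable {L : Type*} [Field L] {A B : L[X]}

lemma eval_right_ne_zero_of_isCoprime (hAB : IsCoprime A B) {c x : L}
    (hx : (A - C c * B).eval x = 0) : B.eval x ≠ 0 := by
  intro hB
  obtain ⟨u, v, huv⟩ := hAB
  have hA : A.eval x = 0 := by simpa [hB] using hx
  simpa [hA, hB] using congrArg (eval x) huv

lemma eval_sub_C_mul_eq_zero_iff {c x : L} (hB : B.eval x ≠ 0) :
    (A - C c * B).eval x = 0 ↔ A.eval x / B.eval x = c := by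
  rw [div_eq_iff hB, eval_sub, eval_C_mul, sub_eq_zero]

lemma eventually_forall_root (hAB : IsCoprime A B) {p : L → Prop} (hp : ∀ᶠ x in cofinite, p x) :
    ∀ᶠ c in cofinite, ∀ x, (A - C c * B).eval x = 0 → p x := by
  filter_upwards [eventually_forall_of_map_eq hp fun x => A.eval x / B.eval x] with c hc x hx
  exact hc x ((eval_sub_C_mul_eq_zero_iff (eval_right_ne_zero_of_isCoprime hAB hx)).mp hx)

/-- The generic member of the pencil `A - c B`, whose roots are the fibre of `A / B` above `c`;
the outer variable is the point of the fibre and the inner one is `c`. -/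
noncomputable def fibrePoly (A B : L[X]) : L[X][X] :=
  A.map C - C X * B.map C

lemma map_evalRingHom_fibrePoly (A B : L[X]) (c : L) :
    (fibrePoly A B).map (evalRingHom c) = A - C c * B := by
  have hC : (evalRingHom c).comp C = RingHom.id L := by
    ext a
    simp
  simp [fibrePoly, Polynomial.map_map, hC]

lemma natDegree_fibrePoly (A B : L[X]) :
    (fibrePoly A B).natDegree = max A.natDegree B.natDegree := by
  refine eq_of_forall_ge_iff fun n => ?_
  simp only [max_le_iff, natDegree_le_iff_coeff_eq_zero, ← forall_and]
  refine forall_congr' fun i => ?_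
  have hcoeff : (fibrePoly A B).coeff i = C (A.coeff i) - X * C (B.coeff i) := by
    simp [fibrePoly]
  rw [hcoeff]
  refine imp_congr_right fun _ => ⟨fun h => ⟨?_, ?_⟩, fun h => by simp [h]⟩
  · simpa using congrArg (coeff · 0) h
  · simpa [coeff_C] using congrArg (coeff · 1) h

lemma eventually_natDegree_sub_C_mul (A B : L[X]) :
    ∀ᶠ c in cofinite, (A - C c * B).natDegree = max A.natDegree B.natDegree := by
  by_cases h0 : fibrePoly A B = 0
  · exact .of_forall fun c => by
      rw [← natDegree_fibrePoly, ← map_evalRingHom_fibrePoly, h0, Polynomial.map_zero,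
        natDegree_zero, natDegree_zero]
  · filter_upwards [eventually_eval_ne_zero (leadingCoeff_ne_zero.mpr h0)] with c hc
    rw [← map_evalRingHom_fibrePoly, natDegree_map_of_leadingCoeff_ne_zero _ hc,
      natDegree_fibrePoly]

variable [CharZero L]

lemma wronskian_ne_zero_of_isCoprime (hAB : IsCoprime A B)
    (hN : 0 < max A.natDegree B.natDegree) : wronskian A B ≠ 0 := by
  intro h
  obtain ⟨hA, hB⟩ := hAB.wronskian_eq_zero_iff.mp h
  rw [derivative_eq_zero.mp hA, derivative_eq_zero.mp hB] at hN
  exact hN.ne' (max_self 0)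

lemma eventually_card_roots_sub_C_mul [DecidableEq L] [IsAlgClosed L] (hAB : IsCoprime A B)
    (hN : 0 < max A.natDegree B.natDegree) :
    ∀ᶠ c in cofinite, A - C c * B ≠ 0 ∧
      (A - C c * B).roots.toFinset.card = max A.natDegree B.natDegree := by
  filter_upwards [eventually_natDegree_sub_C_mul A B, eventually_forall_root hAB
    (eventually_eval_ne_zero (wronskian_ne_zero_of_isCoprime hAB hN))] with c hdeg hw
  have h0 : A - C c * B ≠ 0 := ne_zero_of_natDegree_gt (hdeg.symm ▸ hN)
  have hnodup : (A - C c * B).roots.Nodup := by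
    refine Multiset.nodup_iff_count_le_one.mpr fun z => ?_
    rw [count_roots]
    by_contra! hz
    obtain ⟨hroot, hderiv⟩ := (one_lt_rootMultiplicity_iff_isRoot h0).mp hz
    refine hw z hroot ?_
    simp only [derivative_sub, derivative_C_mul, IsRoot.def, eval_sub, eval_C_mul] at hroot hderiv
    rw [wronskian, eval_sub, eval_mul, eval_mul]
    linear_combination B.derivative.eval z * hroot - B.eval z * hderiv
  rw [Multiset.toFinset_card_of_nodup hnodup, ← hdeg]
  exact ⟨h0, splits_iff_card_roots.mp (IsAlgClosed.splits _)⟩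

end RationalFunctionFibres

section IsogenyFibres

variable {L : Type*} [Field L] [DecidableEq L] {W W' W'' : WeierstrassCurve L}

lemma ncard_xCoord_fibre {φ : W.toAffine.Point →+ W'.toAffine.Point}
    {P₀ : W.toAffine.Point} (hω : oddCoord (φ P₀) ≠ 0) :
    (xCoord '' {P | φ P ≠ 0 ∧ xCoord (φ P) = xCoord (φ P₀)}).ncard = Nat.card φ.ker := by
  have hQneg : φ P₀ ≠ -φ P₀ := fun h => hω (oddCoord_eq_zero_iff.mpr h)
  have hQ0 : φ P₀ ≠ 0 := fun h => hQneg (by rw [h, neg_zero])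
  have hmem (κ : φ.ker) : φ (P₀ + κ.1) = φ P₀ := by rw [map_add, κ.2, add_zero]
  have hne (κ : φ.ker) : P₀ + κ.1 ≠ 0 := fun h => hQ0 (by rw [← hmem κ, h, map_zero])
  rw [← Nat.card_coe_set_eq]
  refine (Nat.card_eq_of_bijective (fun κ : φ.ker => ⟨xCoord (P₀ + κ.1), P₀ + κ.1,
    ⟨(hmem κ).trans_ne hQ0, by rw [hmem]⟩, rfl⟩) ⟨fun κ κ' h => ?_, ?_⟩).symm
  · rcases eq_or_eq_neg_of_xCoord_eq (hne κ) (hne κ') (congrArg Subtype.val h) with h | h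
    · exact Subtype.ext (add_left_cancel h)
    · refine absurd ?_ hQneg
      nth_rw 1 [← hmem κ]
      rw [h, map_neg, hmem]
  · rintro ⟨_, P, ⟨hP0, hP⟩, rfl⟩
    rcases eq_or_eq_neg_of_xCoord_eq hP0 hQ0 hP with h | h
    · exact ⟨⟨P - P₀, by simp [AddMonoidHom.mem_ker, h]⟩, Subtype.ext (by simp)⟩
    · exact ⟨⟨-P - P₀, by simp [AddMonoidHom.mem_ker, h]⟩, Subtype.ext (by simp)⟩

variable [IsAlgClosed L] [W.IsElliptic] {φ : W.toAffine.Point →+ W'.toAffine.Point} {A B : L[X]}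

lemma HasXCoordFormula.max_natDegree_pos (hAB : HasXCoordFormula φ A B) (h : IsIsogeny L φ) :
    0 < max A.natDegree B.natDegree := by
  have := infinite_point W
  by_contra! hN
  obtain ⟨a, ha⟩ := natDegree_eq_zero.mp (Nat.le_zero.mp ((le_max_left _ _).trans hN))
  obtain ⟨b, hb⟩ := natDegree_eq_zero.mp (Nat.le_zero.mp ((le_max_right _ _).trans hN))
  have hne : ∀ᶠ P in cofinite, xCoord (φ P) ≠ a / b :=
    (tendsto_xCoord.comp h.tendsto).eventually (Set.finite_singleton _).eventually_cofinite_notMem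
  obtain ⟨P, hx, hne⟩ := (hAB.eventually_eq.and hne).exists
  rw [← ha, ← hb, eval_C, eval_C] at hx
  exact hne hx

lemma HasXCoordFormula.eventually_root_iff (hAB : HasXCoordFormula φ A B) (h : IsIsogeny L φ) :
    ∀ᶠ c in cofinite, ∀ x, (A - C c * B).eval x = 0 ↔
      x ∈ xCoord '' {P | φ P ≠ 0 ∧ xCoord (φ P) = c} := by
  have hgood : ∀ᶠ P in cofinite, φ P ≠ 0 ∧
      xCoord (φ P) = A.eval (xCoord P) / B.eval (xCoord P) ∧ B.eval (xCoord P) ≠ 0 :=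
    h.eventually_ne_zero.and
      (hAB.eventually_eq.and (eventually_eval_xCoord_ne_zero hAB.ne_zero))
  filter_upwards [eventually_forall_root hAB.isCoprime (eventually_forall_of_map_eq hgood xCoord),
    eventually_forall_of_map_eq hgood fun P => xCoord (φ P)] with c hc hc' x
  constructor
  · intro hx
    obtain ⟨P, -, rfl⟩ := exists_xCoord_eq (W := W) x
    obtain ⟨hφP, hφx, hB⟩ := hc _ hx P rfl
    exact ⟨P, ⟨hφP, hφx.trans ((eval_sub_C_mul_eq_zero_iff hB).mp hx)⟩, rfl⟩
  · rintro ⟨P, ⟨-, rfl⟩, rfl⟩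
    obtain ⟨-, hφx, hB⟩ := hc' P rfl
    exact (eval_sub_C_mul_eq_zero_iff hB).mpr hφx.symm

variable [CharZero L]

lemma IsIsogeny.surjective [W'.IsElliptic] (h : IsIsogeny L φ) : Function.Surjective φ := by
  obtain ⟨A, B, hAB⟩ := h.exists_hasXCoordFormula
  have := infinite_point W'
  rw [← AddMonoidHom.range_eq_top]
  refine eq_top_of_eventually_mem ?_
  filter_upwards [tendsto_xCoord.eventually (hAB.eventually_root_iff h),
    QuadQCurve.eventually_ne_zero,
    tendsto_xCoord.eventually (eventually_card_roots_sub_C_mul hAB.isCoprime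
      (hAB.max_natDegree_pos h))] with Q hroot hQ0 ⟨h0, hcard⟩
  have hne : (A - C (xCoord Q) * B).roots.toFinset.Nonempty := by
    rw [← Finset.card_pos, hcard]
    exact hAB.max_natDegree_pos h
  obtain ⟨x, hx⟩ := hne
  rw [Multiset.mem_toFinset, mem_roots h0] at hx
  obtain ⟨P, ⟨hP0, hP⟩, -⟩ := (hroot x).mp hx
  rcases eq_or_eq_neg_of_xCoord_eq hP0 hQ0 hP with h | h
  · exact ⟨P, h⟩
  · exact ⟨-P, by rw [map_neg, h, neg_neg]⟩

lemma HasXCoordFormula.card_ker (hAB : HasXCoordFormula φ A B) (h : IsIsogeny L φ) :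
    Nat.card φ.ker = max A.natDegree B.natDegree := by
  have := infinite_point W
  have htendsto : Tendsto (fun P => xCoord (φ P)) cofinite cofinite :=
    tendsto_xCoord.comp h.tendsto
  obtain ⟨P, hroot, hω, h0, hcard⟩ := ((htendsto.eventually (hAB.eventually_root_iff h)).and
    ((h.tendsto.eventually eventually_oddCoord_ne_zero).and (htendsto.eventually
      (eventually_card_roots_sub_C_mul hAB.isCoprime (hAB.max_natDegree_pos h))))).exists
  rw [← ncard_xCoord_fibre hω, ← hcard, ← Set.ncard_coe_finset]
  congr 1
  ext x
  rw [← hroot x, Finset.mem_coe, Multiset.mem_toFinset, mem_roots h0, IsRoot.def]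

end IsogenyFibres
/-! ### Descent along an isogeny -/

section PseudoDivision

lemma exists_C_mul_eq_mul_add {R : Type*} [CommRing R] [IsDomain R] {p : R[X]}
    (hp : 0 < p.natDegree) (q : R[X]) :
    ∃ b : R, b ≠ 0 ∧ ∃ s r : R[X], C b * q = p * s + r ∧ r.natDegree < p.natDegree := by
  induction hn : q.natDegree using Nat.strong_induction_on generalizing q with
  | _ n ih =>
    rcases lt_or_ge q.natDegree p.natDegree with hlt | hle
    · exact ⟨1, one_ne_zero, 0, q, by simp, hlt⟩
    · obtain ⟨b, hb, s, r, hq, hr⟩ := ih _ (hn ▸ natDegree_cancelLeads_lt_of_natDegree_le_natDegree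
        hle (hp.trans_le hle)) (p.cancelLeads q) rfl
      have hp0 : p.leadingCoeff ≠ 0 := leadingCoeff_ne_zero.mpr (ne_zero_of_natDegree_gt hp)
      refine ⟨b * p.leadingCoeff, mul_ne_zero hb hp0,
        s + C b * (C q.leadingCoeff * X ^ (q.natDegree - p.natDegree)), r, ?_, hr⟩
      rw [cancelLeads, Nat.sub_eq_zero_of_le hle, pow_zero, mul_one] at hq
      rw [C_mul]
      linear_combination hq

variable {L : Type*} [Field L] {A B : L[X]}

lemma exists_fibre_remainder (hN : 0 < max A.natDegree B.natDegree) (q : L[X]) :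
    ∃ b : L[X], b ≠ 0 ∧ ∃ r : L[X][X], r.natDegree < max A.natDegree B.natDegree ∧
      ∀ c x, (A - C c * B).eval x = 0 →
        (r.map (evalRingHom c)).eval x = b.eval c * q.eval x := by
  rw [← natDegree_fibrePoly] at hN ⊢
  obtain ⟨b, hb, s, r, hq, hr⟩ := exists_C_mul_eq_mul_add hN (q.map C)
  refine ⟨b, hb, r, hr, fun c x hx => ?_⟩
  have hq := congrArg (fun p => (p.map (evalRingHom c)).eval x) hq
  have hC : (evalRingHom c).comp C = RingHom.id L := RingHom.ext fun a => eval_C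
  simp only [Polynomial.map_mul, Polynomial.map_add, map_evalRingHom_fibrePoly, map_C,
    Polynomial.map_map, hC, Polynomial.map_id, eval_mul, eval_add, eval_C, hx, zero_mul, zero_add,
    coe_evalRingHom] at hq
  exact hq.symm

lemma exists_eval_div_of_forall_root [IsAlgClosed L] [CharZero L] (hAB : IsCoprime A B)
    (hN : 0 < max A.natDegree B.natDegree) {S : L[X]} (hS : S ≠ 0) (T : L[X]) :
    ∃ G H : L[X], H ≠ 0 ∧ ∀ᶠ c in cofinite, ∀ t,
      (∀ x, (A - C c * B).eval x = 0 → T.eval x = t * S.eval x) → t = G.eval c / H.eval c := by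
  classical
  obtain ⟨bS, hbS, rS, hrS, hS_eval⟩ := exists_fibre_remainder hN S
  obtain ⟨bT, hbT, rT, hrT, hT_eval⟩ := exists_fibre_remainder hN T
  have hcard := eventually_card_roots_sub_C_mul hAB hN
  have hrS0 : rS ≠ 0 := by
    rintro rfl
    obtain ⟨c, hS0, hbc, h0, hcard⟩ := ((eventually_forall_root hAB
      (eventually_eval_ne_zero hS)).and ((eventually_eval_ne_zero hbS).and hcard)).exists
    obtain ⟨x, hx⟩ := Finset.card_pos.mp (hcard.symm ▸ hN)
    rw [Multiset.mem_toFinset, mem_roots h0] at hx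
    refine mul_ne_zero hbc (hS0 x hx) ?_
    rw [← hS_eval c x hx, Polynomial.map_zero, eval_zero]
  obtain ⟨i, hi⟩ : ∃ i, rS.coeff i ≠ 0 := by
    by_contra! h
    exact hrS0 (Polynomial.ext fun i => h i)
  have hH : bT * rS.coeff i ≠ 0 := mul_ne_zero hbT hi
  refine ⟨bS * rT.coeff i, bT * rS.coeff i, hH, ?_⟩
  filter_upwards [hcard, eventually_eval_ne_zero hH] with c ⟨h0, hcard⟩ hc t ht
  have hzero : C (bS.eval c) * rT.map (evalRingHom c) -
      C (t * bT.eval c) * rS.map (evalRingHom c) = 0 := by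
    refine eq_zero_of_natDegree_lt_card_of_eval_eq_zero' _ (A - C c * B).roots.toFinset
      (fun x hx => ?_) ?_
    · rw [Multiset.mem_toFinset, mem_roots h0] at hx
      rw [eval_sub, eval_C_mul, eval_C_mul, hT_eval c x hx, hS_eval c x hx, ht x hx]
      ring
    · rw [hcard]
      exact (natDegree_sub_le _ _).trans_lt (max_lt
        (((natDegree_C_mul_le _ _).trans natDegree_map_le).trans_lt hrT)
        (((natDegree_C_mul_le _ _).trans natDegree_map_le).trans_lt hrS))
  have hcoeff := congrArg (coeff · i) hzero
  simp only [coeff_sub, coeff_C_mul, coeff_map, coe_evalRingHom, coeff_zero] at hcoeff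
  rw [eq_div_iff hc, eval_mul, eval_mul]
  linear_combination -hcoeff

end PseudoDivision

section Descent

variable {L : Type*} [Field L] [DecidableEq L] [IsAlgClosed L] [CharZero L]
  {W W' W'' : WeierstrassCurve L} [W.IsElliptic] {φ : W.toAffine.Point →+ W'.toAffine.Point}

namespace IsIsogeny

lemma exists_eval_div_eval_comp (hφ : IsIsogeny L φ) {f : W.toAffine.Point → L} (hf : IsRatFun f)
    (heven : ∀ P, f (-P) = f P)
    (hconst : ∀ P Q, φ P ≠ 0 → φ Q ≠ 0 → xCoord (φ P) = xCoord (φ Q) → f P = f Q) :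
    ∃ G H : L[X], H ≠ 0 ∧
      ∀ᶠ P in cofinite, f P = G.eval (xCoord (φ P)) / H.eval (xCoord (φ P)) := by
  obtain ⟨T, S, hS, hf⟩ := hf.exists_eval_div_eval_of_even heven
  obtain ⟨A, B, hAB⟩ := hφ.exists_hasXCoordFormula
  obtain ⟨G, H, hH, hGH⟩ :=
    exists_eval_div_of_forall_root hAB.isCoprime (hAB.max_natDegree_pos hφ) hS T
  refine ⟨G, H, hH, ?_⟩
  have hfibre := eventually_forall_root hAB.isCoprime
    (eventually_forall_of_map_eq (hf.and (eventually_eval_xCoord_ne_zero hS)) xCoord)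
  have htendsto : Tendsto (fun P => xCoord (φ P)) cofinite cofinite :=
    tendsto_xCoord.comp hφ.tendsto
  filter_upwards [htendsto.eventually hGH, htendsto.eventually hfibre,
    htendsto.eventually (hAB.eventually_root_iff hφ), hφ.eventually_ne_zero]
    with P hGH hfibre hroot hP
  refine hGH _ fun x hx => ?_
  obtain ⟨Q, ⟨hQ, hQx⟩, rfl⟩ := (hroot x).mp hx
  obtain ⟨hfQ, hSQ⟩ := hfibre _ hx Q rfl
  rw [hconst P Q hP hQ hQx.symm, hfQ, div_mul_cancel₀ _ hSQ]

variable [W'.IsElliptic]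

lemma eventually_of_eventually_comp (hφ : IsIsogeny L φ) {p : W'.toAffine.Point → Prop}
    (h : ∀ᶠ P in cofinite, p (φ P)) : ∀ᶠ Q in cofinite, p Q := by
  rw [eventually_cofinite] at h ⊢
  refine (h.image φ).subset fun Q hQ => ?_
  obtain ⟨P, rfl⟩ := hφ.surjective Q
  exact ⟨P, hQ, rfl⟩

lemma of_comp (hφ : IsIsogeny L φ) {g : W'.toAffine.Point →+ W''.toAffine.Point}
    (h : IsIsogeny L (g.comp φ)) : IsIsogeny L g := by
  have hfibre : ∀ P Q, φ P ≠ 0 → φ Q ≠ 0 → xCoord (φ P) = xCoord (φ Q) →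
      xCoord (g (φ P)) = xCoord (g (φ Q)) ∧
        oddCoord (g (φ P)) / oddCoord (φ P) = oddCoord (g (φ Q)) / oddCoord (φ Q) := by
    intro P Q hP hQ hPQ
    rcases eq_or_eq_neg_of_xCoord_eq hP hQ hPQ with hPQ | hPQ
    · rw [hPQ]
      exact ⟨rfl, rfl⟩
    · rw [hPQ, map_neg, xCoord_neg, oddCoord_neg, oddCoord_neg, neg_div_neg_eq]
      exact ⟨rfl, rfl⟩
  obtain ⟨G, H, hH, hx⟩ := hφ.exists_eval_div_eval_comp h.isRatFun_xCoord
    (fun P => by rw [map_neg, xCoord_neg]) fun P Q hP hQ hPQ => (hfibre P Q hP hQ hPQ).1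
  obtain ⟨G', H', hH', hω⟩ := hφ.exists_eval_div_eval_comp
    (h.isRatFun_oddCoord.div hφ.isRatFun_oddCoord)
    (fun P => by rw [map_neg, map_neg, oddCoord_neg, oddCoord_neg, neg_div_neg_eq])
    fun P Q hP hQ hPQ => (hfibre P Q hP hQ hPQ).2
  refine isIsogeny_of_isRatFun_oddCoord (hφ.eventually_of_eventually_comp h.eventually_ne_zero)
    ⟨G, 0, H, hH, hφ.eventually_of_eventually_comp ?_⟩
    ⟨0, G', H', hH', hφ.eventually_of_eventually_comp ?_⟩
  · filter_upwards [hx] with P hP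
    rw [eval_zero, zero_mul, add_zero]
    exact hP
  · filter_upwards [hω, hφ.tendsto.eventually eventually_oddCoord_ne_zero] with P hP hω
    rw [AddMonoidHom.comp_apply, div_eq_iff hω] at hP
    rw [hP, eval_zero, zero_add, div_mul_eq_mul_div]

lemma exists_comp_eq (hφ : IsIsogeny L φ) {h : W.toAffine.Point →+ W''.toAffine.Point}
    (hh : IsIsogeny L h) (hker : φ.ker ≤ h.ker) :
    ∃ ψ : W'.toAffine.Point →+ W''.toAffine.Point, IsIsogeny L ψ ∧ ψ.comp φ = h := by
  have hcomp : (φ.liftOfSurjective hφ.surjective ⟨h, hker⟩).comp φ = h :=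
    φ.liftOfRightInverse_comp _ _ ⟨h, hker⟩
  exact ⟨_, hφ.of_comp (hcomp.symm ▸ hh), hcomp⟩

end IsIsogeny

end Descent
/-! ### Sums and multiples of isogenies -/

section Sums

variable {L : Type*} [Field L] [DecidableEq L] {W W' : WeierstrassCurve L}

section Chord

variable {P Q : W.toAffine.Point}

lemma xCoord_add_and_yCoord_add (hP : P ≠ 0) (hQ : Q ≠ 0) (h : P + Q ≠ 0) {s : L}
    (hs : W.toAffine.slope (xCoord P) (xCoord Q) (yCoord P) (yCoord Q) = s) :
    xCoord (P + Q) = W.toAffine.addX (xCoord P) (xCoord Q) s ∧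
      yCoord (P + Q) = W.toAffine.addY (xCoord P) (xCoord Q) (yCoord P) s := by
  match P, Q, hP, hQ with
  | .zero, _, hP, _ => exact absurd rfl hP
  | _, .zero, _, hQ => exact absurd rfl hQ
  | .some x₁ y₁ h₁, .some x₂ y₂ h₂, _, _ =>
    subst hs
    rw [Affine.Point.add_some fun h' => h (Affine.Point.add_of_Y_eq h'.1 h'.2)]
    exact ⟨rfl, rfl⟩

lemma slope_self (hP : P ≠ 0) (h : oddCoord P ≠ 0) :
    W.toAffine.slope (xCoord P) (xCoord P) (yCoord P) (yCoord P) =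
      (3 * xCoord P ^ 2 + 2 * W.a₂ * xCoord P + W.a₄ - W.a₁ * yCoord P) / oddCoord P := by
  have hω : yCoord P - W.toAffine.negY (xCoord P) (yCoord P) = oddCoord P := by
    rw [oddCoord_eq hP, Affine.negY]
    ring
  rw [Affine.slope_of_Y_ne rfl (sub_ne_zero.mp (hω.trans_ne h)), hω]

lemma add_ne_zero_of_xCoord_ne (h : xCoord P ≠ xCoord Q) : P + Q ≠ 0 := fun h0 =>
  h (by rw [eq_neg_of_add_eq_zero_left h0, xCoord_neg])

end Chord

variable [CharZero L]

lemma isIsogeny_id : IsIsogeny L (AddMonoidHom.id W.toAffine.Point) :=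
  isIsogeny_of_isRatFun_oddCoord eventually_ne_zero .xCoord .oddCoord

namespace IsIsogeny

variable {φ ψ : W.toAffine.Point →+ W'.toAffine.Point}

lemma isRatFun_yCoord (hφ : IsIsogeny L φ) : IsRatFun fun P => yCoord (φ P) :=
  hφ.isRatFun_comp .yCoord

lemma add_of_isRatFun_slope (hφ : IsIsogeny L φ) (hψ : IsIsogeny L ψ)
    (h0 : ∀ᶠ P in cofinite, φ P + ψ P ≠ 0) {s : W.toAffine.Point → L} (hs : IsRatFun s)
    (hslope : ∀ᶠ P in cofinite, W'.toAffine.slope (xCoord (φ P)) (xCoord (ψ P)) (yCoord (φ P))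
      (yCoord (ψ P)) = s P) :
    IsIsogeny L (φ + ψ) := by
  have hsum : ∀ᶠ P in cofinite,
      xCoord (φ P + ψ P) = W'.toAffine.addX (xCoord (φ P)) (xCoord (ψ P)) (s P) ∧
        yCoord (φ P + ψ P) =
          W'.toAffine.addY (xCoord (φ P)) (xCoord (ψ P)) (yCoord (φ P)) (s P) := by
    filter_upwards [hφ.eventually_ne_zero, hψ.eventually_ne_zero, h0, hslope]
      with P hφP hψP h0 hs using xCoord_add_and_yCoord_add hφP hψP h0 hs
  have hx : IsRatFun fun P => xCoord (φ P + ψ P) :=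
    (((((hs.pow 2).add ((IsRatFun.const W'.a₁).mul hs)).sub (.const W'.a₂)).sub
      hφ.isRatFun_xCoord).sub hψ.isRatFun_xCoord).congr (hsum.mono fun _ h => h.1)
  refine isIsogeny_of_isRatFun_yCoord h0 hx (((((hs.mul (hx.sub hφ.isRatFun_xCoord)).add
    hφ.isRatFun_yCoord).neg.sub ((IsRatFun.const W'.a₁).mul hx)).sub (.const W'.a₃)).congr ?_)
  filter_upwards [hsum] with P hP
  rw [AddMonoidHom.add_apply, hP.1, hP.2, Affine.addY, Affine.negY, Affine.negAddY]

lemma add_of_xCoord_ne (hφ : IsIsogeny L φ) (hψ : IsIsogeny L ψ)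
    (h : ∀ᶠ P in cofinite, xCoord (φ P) ≠ xCoord (ψ P)) : IsIsogeny L (φ + ψ) :=
  hφ.add_of_isRatFun_slope hψ (h.mono fun _ => add_ne_zero_of_xCoord_ne)
    ((hφ.isRatFun_yCoord.sub hψ.isRatFun_yCoord).div (hφ.isRatFun_xCoord.sub hψ.isRatFun_xCoord))
    (h.mono fun _ => Affine.slope_of_X_ne)

lemma eventually_oddCoord_ne_zero (hφ : IsIsogeny L φ) :
    ∀ᶠ P in cofinite, oddCoord (φ P) ≠ 0 :=
  hφ.tendsto.eventually QuadQCurve.eventually_oddCoord_ne_zero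

lemma add_self (hφ : IsIsogeny L φ) : IsIsogeny L (φ + φ) := by
  have hx := hφ.isRatFun_xCoord
  have hω := hφ.eventually_oddCoord_ne_zero
  refine hφ.add_of_isRatFun_slope hφ (hω.mono fun P hω h0 => ?_)
    (((((IsRatFun.const 3).mul (hx.pow 2)).add ((IsRatFun.const (2 * W'.a₂)).mul hx)).add
      (.const W'.a₄)).sub ((IsRatFun.const W'.a₁).mul hφ.isRatFun_yCoord) |>.div
        hφ.isRatFun_oddCoord) ?_
  · exact hω (oddCoord_eq_zero_iff.mpr (eq_neg_of_add_eq_zero_left h0))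
  · filter_upwards [hφ.eventually_ne_zero, hω] with P hP hω using slope_self hP hω

lemma neg (hφ : IsIsogeny L φ) : IsIsogeny L (-φ) :=
  isIsogeny_of_isRatFun_oddCoord (hφ.eventually_ne_zero.mono fun _ => neg_ne_zero.mpr)
    (hφ.isRatFun_xCoord.congr (.of_forall fun _ => xCoord_neg _))
    (hφ.isRatFun_oddCoord.neg.congr (.of_forall fun _ => oddCoord_neg _))

variable [IsAlgClosed L] [W.IsElliptic]

lemma eq_or_eq_neg_or_eventually_xCoord_ne (hφ : IsIsogeny L φ) (hψ : IsIsogeny L ψ) :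
    φ = ψ ∨ φ = -ψ ∨ ∀ᶠ P in cofinite, xCoord (φ P) ≠ xCoord (ψ P) := by
  have := infinite_point W
  rcases (hφ.isRatFun_xCoord.sub hψ.isRatFun_xCoord).eventually_eq_zero_or_eventually_ne_zero
    with hx | hx
  · have hpm : ∀ᶠ P in cofinite, φ P = ψ P ∨ φ P = -ψ P := by
      filter_upwards [hx, hφ.eventually_ne_zero, hψ.eventually_ne_zero] with P hx hφP hψP
      exact eq_or_eq_neg_of_xCoord_eq hφP hψP (sub_eq_zero.mp hx)
    rcases (hφ.isRatFun_oddCoord.add hψ.isRatFun_oddCoord).eventually_eq_zero_or_eventually_ne_zero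
      with hω | hω
    · refine .inr (.inl (hom_ext_of_eventually_eq ?_))
      filter_upwards [hpm, hω, hψ.eventually_oddCoord_ne_zero] with P hpm hω hψω
      refine hpm.resolve_left fun h => hψω ?_
      rwa [h, ← two_mul, mul_eq_zero_iff_left two_ne_zero] at hω
    · refine .inl (hom_ext_of_eventually_eq ?_)
      filter_upwards [hpm, hω] with P hpm hω
      exact hpm.resolve_right fun h => hω (by rw [h, oddCoord_neg, neg_add_cancel])
  · exact .inr (.inr (hx.mono fun _ => sub_ne_zero.mp))

lemma add (hφ : IsIsogeny L φ) (hψ : IsIsogeny L ψ) (h : φ + ψ ≠ 0) : IsIsogeny L (φ + ψ) := by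
  rcases hφ.eq_or_eq_neg_or_eventually_xCoord_ne hψ with rfl | rfl | hne
  · exact hφ.add_self
  · exact absurd (neg_add_cancel ψ) h
  · exact hφ.add_of_xCoord_ne hψ hne

end IsIsogeny

end Sums

section Multiples

variable {L : Type*} [Field L] [DecidableEq L] [IsAlgClosed L] [CharZero L]
  {W W' : WeierstrassCurve L}

variable (W) in
lemma card_roots_Ψ₂Sq [W.IsElliptic] : W.Ψ₂Sq.roots.toFinset.card = 3 := by
  have h := Cubic.card_roots_of_discr_ne_zero (φ := RingHom.id L) (P := W.twoTorsionPolynomial)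
    (by simp [twoTorsionPolynomial]) (IsAlgClosed.splits _)
    (W.twoTorsionPolynomial_discr_ne_zero_of_isElliptic (isUnit_iff_ne_zero.mpr two_ne_zero))
  rwa [Cubic.map_roots, Polynomial.map_id, ← Ψ₂Sq_eq] at h

variable (W) in
omit [DecidableEq L] in
lemma ncard_oddCoord_eq_zero [W.IsElliptic] :
    {P : W.toAffine.Point | P ≠ 0 ∧ oddCoord P = 0}.ncard = 3 := by
  classical
  have hinj : Set.InjOn xCoord {P : W.toAffine.Point | P ≠ 0 ∧ oddCoord P = 0} := by
    rintro P ⟨hP, -⟩ Q ⟨hQ, hω⟩ h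
    rcases eq_or_eq_neg_of_xCoord_eq hP hQ h with h | h
    · exact h
    · rwa [← oddCoord_eq_zero_iff.mp hω] at h
  rw [← hinj.ncard_image, ← card_roots_Ψ₂Sq W, ← Set.ncard_coe_finset]
  congr 1
  ext x
  simp only [Set.mem_image, Set.mem_ofPred_eq, Finset.mem_coe, Multiset.mem_toFinset,
    mem_roots (W.Ψ₂Sq_ne_zero (by norm_num)), IsRoot.def]
  constructor
  · rintro ⟨P, ⟨hP, hω⟩, rfl⟩
    rw [← oddCoord_sq hP, hω, zero_pow two_ne_zero]
  · intro hx
    obtain ⟨P, hP, rfl⟩ := exists_xCoord_eq (W := W) x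
    exact ⟨P, ⟨hP, by rwa [← oddCoord_sq hP, sq_eq_zero_iff] at hx⟩, rfl⟩

variable (W) in
lemma card_torsionBy_two [W.IsElliptic] :
    Nat.card (AddSubgroup.torsionBy W.toAffine.Point 2) = 4 := by
  have htorsion : (AddSubgroup.torsionBy W.toAffine.Point 2 : Set W.toAffine.Point) =
      insert 0 {P | P ≠ 0 ∧ oddCoord P = 0} := by
    ext P
    have hP : P ∈ AddSubgroup.torsionBy W.toAffine.Point 2 ↔ P = -P := by
      rw [eq_neg_iff_add_eq_zero, ← two_zsmul]
      rfl
    rw [SetLike.mem_coe, hP, Set.mem_insert_iff, Set.mem_ofPred_eq, oddCoord_eq_zero_iff]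
    by_cases h : P = 0 <;> simp [h]
  have hncard := ncard_oddCoord_eq_zero W
  change Nat.card (AddSubgroup.torsionBy W.toAffine.Point 2 : Set W.toAffine.Point) = 4
  rw [Nat.card_coe_set_eq, htorsion, Set.ncard_insert_of_notMem (fun h => h.1 rfl)
    (Set.finite_of_ncard_ne_zero (hncard.trans_ne three_ne_zero)), hncard]

variable (W) in
lemma exists_ne_zero_two_nsmul_eq_zero [W.IsElliptic] :
    ∃ P : W.toAffine.Point, P ≠ 0 ∧ 2 • P = 0 := by
  obtain ⟨P, hP, hω⟩ := Set.nonempty_of_ncard_ne_zero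
    ((ncard_oddCoord_eq_zero W).trans_ne three_ne_zero)
  refine ⟨P, hP, ?_⟩
  rwa [two_nsmul, ← eq_neg_iff_add_eq_zero, ← oddCoord_eq_zero_iff]

namespace IsIsogeny

variable [W.IsElliptic] [W'.IsElliptic] {φ : W.toAffine.Point →+ W'.toAffine.Point}

lemma nsmul (hφ : IsIsogeny L φ) {n : ℕ} (hn : n ≠ 0) : IsIsogeny L (n • φ) := by
  induction n using Nat.evenOddRec with
  | h0 => exact absurd rfl hn
  | h_even n ih =>
    rw [two_mul, add_nsmul]
    exact (ih (by omega)).add_self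
  | h_odd n ih =>
    rw [add_nsmul, one_nsmul]
    rcases eq_or_ne n 0 with rfl | hn
    · simpa only [mul_zero, zero_nsmul, zero_add] using hφ
    rw [two_mul, add_nsmul]
    refine (ih hn).add_self.add hφ fun h => ?_
    obtain ⟨Q, hQ, h2Q⟩ := exists_ne_zero_two_nsmul_eq_zero W'
    obtain ⟨P, rfl⟩ := hφ.surjective Q
    refine hQ ?_
    calc φ P = n • 2 • φ P + φ P := by rw [h2Q, nsmul_zero, zero_add]
      _ = (n • φ + n • φ + φ) P := by
        simp only [AddMonoidHom.add_apply, AddMonoidHom.nsmul_apply, two_nsmul, nsmul_add]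
      _ = 0 := by rw [h, AddMonoidHom.zero_apply]

lemma zsmul (hφ : IsIsogeny L φ) {n : ℤ} (hn : n ≠ 0) : IsIsogeny L (n • φ) := by
  have hnat := hφ.nsmul (Int.natAbs_ne_zero.mpr hn)
  rcases Int.natAbs_eq n with h | h
  · rwa [h, natCast_zsmul]
  · rw [h, neg_zsmul, natCast_zsmul]
    exact hnat.neg

end IsIsogeny

end Multiples

/-! ### The parallelogram inequality for degrees -/

section SumDifference

variable {L : Type*} [Field L] {W : WeierstrassCurve L}

/-- If `A₁ / B₁` and `A₂ / B₂` are the `x`-coordinates of `P` and `Q`, this is, up to the factor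
`(A₁ * B₂ - B₁ * A₂) ^ 2`, the product `(c - x (P + Q)) * (c - x (P - Q))`. It is homogeneous of
bidegree `(2, 2)` in the pairs `(A₁, B₁)`, `(A₂, B₂)`, which is the source of the parallelogram
inequality for degrees. -/
noncomputable def sumDiffPoly (W : WeierstrassCurve L) (A₁ B₁ A₂ B₂ : L[X]) (c : L) : L[X] :=
  let s := A₁ * A₂
  let t := A₁ * B₂ + B₁ * A₂
  let u := B₁ * B₂
  C (c ^ 2) * (t * t) + s * s - C (2 * c) * (s * t) -
    C (4 * c ^ 2 + W.b₂ * c + W.b₄) * (s * u) - C (W.b₄ * c + W.b₆) * (t * u) -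
    C (W.b₆ * c + W.b₈) * (u * u)

lemma natDegree_sumDiffPoly_le {A₁ B₁ A₂ B₂ : L[X]} {m n : ℕ} (hA₁ : A₁.natDegree ≤ m)
    (hB₁ : B₁.natDegree ≤ m) (hA₂ : A₂.natDegree ≤ n) (hB₂ : B₂.natDegree ≤ n) (c : L) :
    (sumDiffPoly W A₁ B₁ A₂ B₂ c).natDegree ≤ 2 * (m + n) := by
  have hs : (A₁ * A₂).natDegree ≤ m + n := natDegree_mul_le_of_le hA₁ hA₂
  have ht : (A₁ * B₂ + B₁ * A₂).natDegree ≤ m + n :=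
    natDegree_add_le_of_degree_le (natDegree_mul_le_of_le hA₁ hB₂) (natDegree_mul_le_of_le hB₁ hA₂)
  have hu : (B₁ * B₂).natDegree ≤ m + n := natDegree_mul_le_of_le hB₁ hB₂
  have hmul {p q : L[X]} (hp : p.natDegree ≤ m + n) (hq : q.natDegree ≤ m + n) :
      (p * q).natDegree ≤ 2 * (m + n) := (natDegree_mul_le_of_le hp hq).trans_eq (two_mul _).symm
  have hC (a : L) {p : L[X]} (hp : p.natDegree ≤ 2 * (m + n)) :
      (C a * p).natDegree ≤ 2 * (m + n) := (natDegree_C_mul_le a p).trans hp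
  have hsub {p q : L[X]} (hp : p.natDegree ≤ 2 * (m + n)) (hq : q.natDegree ≤ 2 * (m + n)) :
      (p - q).natDegree ≤ 2 * (m + n) := (natDegree_sub_le p q).trans (max_le hp hq)
  exact hsub (hsub (hsub (hsub
    (natDegree_add_le_of_degree_le (hC _ (hmul ht ht)) (hmul hs hs)) (hC _ (hmul hs ht)))
    (hC _ (hmul hs hu))) (hC _ (hmul ht hu))) (hC _ (hmul hu hu))

variable [DecidableEq L] [CharZero L] {P Q : W.toAffine.Point}

lemma xCoord_add_eq (hP : P ≠ 0) (hQ : Q ≠ 0) (h : xCoord P ≠ xCoord Q) :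
    xCoord (P + Q) = (oddCoord P - oddCoord Q) ^ 2 / (4 * (xCoord P - xCoord Q) ^ 2) -
      W.b₂ / 4 - xCoord P - xCoord Q := by
  have h' : xCoord P - xCoord Q ≠ 0 := sub_ne_zero.mpr h
  rw [(xCoord_add_and_yCoord_add hP hQ (add_ne_zero_of_xCoord_ne h)
    (Affine.slope_of_X_ne h)).1, Affine.addX, oddCoord_eq hP, oddCoord_eq hQ, b₂]
  field_simp
  ring

lemma xCoord_sub_eq (hP : P ≠ 0) (hQ : Q ≠ 0) (h : xCoord P ≠ xCoord Q) :
    xCoord (P - Q) = (oddCoord P + oddCoord Q) ^ 2 / (4 * (xCoord P - xCoord Q) ^ 2) -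
      W.b₂ / 4 - xCoord P - xCoord Q := by
  rw [sub_eq_add_neg, xCoord_add_eq hP (neg_ne_zero.mpr hQ) (by rwa [xCoord_neg]), xCoord_neg,
    oddCoord_neg, sub_neg_eq_add]

lemma xCoord_add_add_xCoord_sub (hP : P ≠ 0) (hQ : Q ≠ 0) (h : xCoord P ≠ xCoord Q) :
    (xCoord P - xCoord Q) ^ 2 * (xCoord (P + Q) + xCoord (P - Q)) =
      2 * (xCoord P + xCoord Q) * (xCoord P * xCoord Q) + W.b₂ * (xCoord P * xCoord Q) +
        W.b₄ * (xCoord P + xCoord Q) + W.b₆ := by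
  have h' : xCoord P - xCoord Q ≠ 0 := sub_ne_zero.mpr h
  have hωP := oddCoord_sq hP
  have hωQ := oddCoord_sq hQ
  simp only [Ψ₂Sq, eval_add, eval_mul, eval_C, eval_pow, eval_X] at hωP hωQ
  rw [xCoord_add_eq hP hQ h, xCoord_sub_eq hP hQ h]
  field_simp
  linear_combination 2 * hωP + 2 * hωQ

lemma xCoord_add_mul_xCoord_sub (hP : P ≠ 0) (hQ : Q ≠ 0) (h : xCoord P ≠ xCoord Q) :
    (xCoord P - xCoord Q) ^ 2 * (xCoord (P + Q) * xCoord (P - Q)) =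
      (xCoord P * xCoord Q) ^ 2 - W.b₄ * (xCoord P * xCoord Q) -
        W.b₆ * (xCoord P + xCoord Q) - W.b₈ := by
  have h' : xCoord P - xCoord Q ≠ 0 := sub_ne_zero.mpr h
  have hωP := oddCoord_sq hP
  have hωQ := oddCoord_sq hQ
  have hb₈ : W.b₈ = (W.b₂ * W.b₆ - W.b₄ ^ 2) / 4 := by linear_combination W.b_relation / 4
  simp only [Ψ₂Sq, eval_add, eval_mul, eval_C, eval_pow, eval_X] at hωP hωQ
  rw [xCoord_add_eq hP hQ h, xCoord_sub_eq hP hQ h, hb₈]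
  generalize xCoord P = x at *
  generalize xCoord Q = z at *
  have hsq : ((oddCoord P - oddCoord Q) ^ 2 / (4 * (x - z) ^ 2) - W.b₂ / 4 - x - z) *
      ((oddCoord P + oddCoord Q) ^ 2 / (4 * (x - z) ^ 2) - W.b₂ / 4 - x - z) =
      (oddCoord P ^ 2 - oddCoord Q ^ 2) ^ 2 / (16 * (x - z) ^ 4) -
        (W.b₂ / 4 + x + z) * (oddCoord P ^ 2 + oddCoord Q ^ 2) / (2 * (x - z) ^ 2) +
        (W.b₂ / 4 + x + z) ^ 2 := by
    field_simp
    ring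
  rw [hsq, hωP, hωQ]
  field_simp
  ring

lemma eval_sumDiffPoly (hP : P ≠ 0) (hQ : Q ≠ 0) (h : xCoord P ≠ xCoord Q)
    {A₁ B₁ A₂ B₂ : L[X]} {x : L} (h₁ : A₁.eval x = xCoord P * B₁.eval x)
    (h₂ : A₂.eval x = xCoord Q * B₂.eval x) (c : L) :
    (sumDiffPoly W A₁ B₁ A₂ B₂ c).eval x =
      (B₁.eval x * B₂.eval x * (xCoord P - xCoord Q)) ^ 2 *
        ((c - xCoord (P + Q)) * (c - xCoord (P - Q))) := by
  simp only [sumDiffPoly, eval_add, eval_sub, eval_mul, eval_C, h₁, h₂]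
  linear_combination (B₁.eval x * B₂.eval x) ^ 2 *
    (c * xCoord_add_add_xCoord_sub hP hQ h - xCoord_add_mul_xCoord_sub hP hQ h)

end SumDifference

section Parallelogram

variable {L : Type*} [Field L] [DecidableEq L] {W W' : WeierstrassCurve L}
  {φ ψ : W.toAffine.Point →+ W'.toAffine.Point}

lemma disjoint_xCoord_fibre {c : L} (hω : ∀ P, (φ + ψ) P ≠ 0 → xCoord ((φ + ψ) P) = c →
    oddCoord (φ P) ≠ 0 ∧ oddCoord (ψ P) ≠ 0) :
    Disjoint (xCoord '' {P | (φ + ψ) P ≠ 0 ∧ xCoord ((φ + ψ) P) = c})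
      (xCoord '' {P | (φ - ψ) P ≠ 0 ∧ xCoord ((φ - ψ) P) = c}) := by
  rw [Set.disjoint_left]
  rintro _ ⟨P, ⟨hP, hPc⟩, rfl⟩ ⟨Q, ⟨hQ, hQc⟩, hQP⟩
  have hsub : (φ - ψ) P ≠ 0 ∧ xCoord ((φ - ψ) P) = c := by
    have hP0 : P ≠ 0 := fun h => hP (by rw [h, map_zero])
    have hQ0 : Q ≠ 0 := fun h => hQ (by rw [h, map_zero])
    rcases eq_or_eq_neg_of_xCoord_eq hQ0 hP0 hQP with rfl | rfl
    · exact ⟨hQ, hQc⟩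
    · rw [map_neg, xCoord_neg] at hQc
      rw [map_neg, neg_ne_zero] at hQ
      exact ⟨hQ, hQc⟩
  obtain ⟨hωφ, hωψ⟩ := hω P hP hPc
  rcases eq_or_eq_neg_of_xCoord_eq hP hsub.1 (hPc.trans hsub.2.symm) with h | h <;>
    rw [AddMonoidHom.add_apply, AddMonoidHom.sub_apply] at h
  · exact hωψ (oddCoord_eq_zero_iff.mpr (add_left_cancel (h.trans (sub_eq_add_neg _ _))))
  · rw [neg_sub, sub_eq_neg_add] at h
    exact hωφ (oddCoord_eq_zero_iff.mpr (add_right_cancel h))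

namespace IsIsogeny

variable [IsAlgClosed L] [CharZero L] [W.IsElliptic]

lemma eventually_ncard_xCoord_fibre [W'.IsElliptic] (hφ : IsIsogeny L φ) :
    ∀ᶠ c in cofinite,
      (xCoord '' {P | φ P ≠ 0 ∧ xCoord (φ P) = c}).ncard = Nat.card φ.ker := by
  filter_upwards [eventually_forall_of_map_eq
    (QuadQCurve.eventually_oddCoord_ne_zero (W := W')) xCoord] with c hc
  obtain ⟨Q, -, rfl⟩ := exists_xCoord_eq (W := W') c
  obtain ⟨P, rfl⟩ := hφ.surjective Q
  exact ncard_xCoord_fibre (hc _ rfl)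

lemma eventually_eval_sumDiffPoly (hφ : IsIsogeny L φ) (hψ : IsIsogeny L ψ)
    (hadd : φ + ψ ≠ 0) (hsub : φ - ψ ≠ 0) {A₁ B₁ A₂ B₂ : L[X]} (h₁ : HasXCoordFormula φ A₁ B₁)
    (h₂ : HasXCoordFormula ψ A₂ B₂) :
    ∀ᶠ P in cofinite, ∃ e : L, e ≠ 0 ∧ ∀ c,
      (sumDiffPoly W' A₁ B₁ A₂ B₂ c).eval (xCoord P) =
        e * ((c - xCoord ((φ + ψ) P)) * (c - xCoord ((φ - ψ) P))) := by
  have hne : ∀ᶠ P in cofinite, xCoord (φ P) ≠ xCoord (ψ P) :=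
    ((hφ.eq_or_eq_neg_or_eventually_xCoord_ne hψ).resolve_left
      (sub_ne_zero.mp hsub)).resolve_left fun h => hadd (by rw [h, neg_add_cancel])
  filter_upwards [hφ.eventually_ne_zero, hψ.eventually_ne_zero, hne, h₁.eventually_eq,
    h₂.eventually_eq, eventually_eval_xCoord_ne_zero h₁.ne_zero,
    eventually_eval_xCoord_ne_zero h₂.ne_zero] with P hφP hψP hne hx₁ hx₂ hB₁ hB₂
  exact ⟨_, pow_ne_zero 2 (mul_ne_zero (mul_ne_zero hB₁ hB₂) (sub_ne_zero.mpr hne)),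
    eval_sumDiffPoly hφP hψP hne (by rw [hx₁, div_mul_cancel₀ _ hB₁])
      (by rw [hx₂, div_mul_cancel₀ _ hB₂])⟩

lemma eventually_sumDiffPoly_ne_zero (hφ : IsIsogeny L φ) (hψ : IsIsogeny L ψ)
    (hadd : φ + ψ ≠ 0) (hsub : φ - ψ ≠ 0) {A₁ B₁ A₂ B₂ : L[X]} (h₁ : HasXCoordFormula φ A₁ B₁)
    (h₂ : HasXCoordFormula ψ A₂ B₂) :
    ∀ᶠ c in cofinite, sumDiffPoly W' A₁ B₁ A₂ B₂ c ≠ 0 := by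
  have := infinite_point W
  obtain ⟨P, e, he, hP⟩ := (hφ.eventually_eval_sumDiffPoly hψ hadd hsub h₁ h₂).exists
  filter_upwards [(Set.toFinite
    {xCoord ((φ + ψ) P), xCoord ((φ - ψ) P)}).eventually_cofinite_notMem] with c hc h0
  simp only [Set.mem_insert_iff, Set.mem_singleton_iff, not_or, ← sub_eq_zero (a := c)] at hc
  refine mul_ne_zero he (mul_ne_zero hc.1 hc.2) ?_
  rw [← hP, h0, eval_zero]

lemma card_ker_add_add_card_ker_sub_le [W'.IsElliptic] (hφ : IsIsogeny L φ) (hψ : IsIsogeny L ψ)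
    (hadd : IsIsogeny L (φ + ψ)) (hsub : IsIsogeny L (φ - ψ)) :
    Nat.card (φ + ψ).ker + Nat.card (φ - ψ).ker ≤ 2 * (Nat.card φ.ker + Nat.card ψ.ker) := by
  have := infinite_point W
  have : Infinite L := IsAlgClosed.instInfinite
  obtain ⟨A₁, B₁, h₁⟩ := hφ.exists_hasXCoordFormula
  obtain ⟨A₂, B₂, h₂⟩ := hψ.exists_hasXCoordFormula
  have heval := hφ.eventually_eval_sumDiffPoly hψ hadd.ne_zero hsub.ne_zero h₁ h₂
  obtain ⟨c, hc, hcadd, hcsub, hadd', hsub', hω⟩ := (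
    (hφ.eventually_sumDiffPoly_ne_zero hψ hadd.ne_zero hsub.ne_zero h₁ h₂).and
    (hadd.eventually_ncard_xCoord_fibre.and (hsub.eventually_ncard_xCoord_fibre.and
      ((eventually_forall_of_map_eq heval fun P => xCoord ((φ + ψ) P)).and
        ((eventually_forall_of_map_eq heval fun P => xCoord ((φ - ψ) P)).and
          (eventually_forall_of_map_eq (hφ.eventually_oddCoord_ne_zero.and
            hψ.eventually_oddCoord_ne_zero) fun P => xCoord ((φ + ψ) P))))))).exists
  have hroots : xCoord '' {P | (φ + ψ) P ≠ 0 ∧ xCoord ((φ + ψ) P) = c} ∪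
      xCoord '' {P | (φ - ψ) P ≠ 0 ∧ xCoord ((φ - ψ) P) = c} ⊆
        (sumDiffPoly W' A₁ B₁ A₂ B₂ c).roots.toFinset := by
    rintro _ (⟨P, ⟨-, hP⟩, rfl⟩ | ⟨P, ⟨-, hP⟩, rfl⟩) <;>
      rw [Finset.mem_coe, Multiset.mem_toFinset, mem_roots hc, IsRoot.def]
    · obtain ⟨e, -, he⟩ := hadd' P hP
      rw [he, hP, sub_self, zero_mul, mul_zero]
    · obtain ⟨e, -, he⟩ := hsub' P hP
      rw [he, hP, sub_self, mul_zero, mul_zero]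
  rw [← hcadd, ← hcsub, ← Set.ncard_union_eq (disjoint_xCoord_fibre fun P _ => hω P)
    ((Finset.finite_toSet _).subset (Set.subset_union_left.trans hroots))
    ((Finset.finite_toSet _).subset (Set.subset_union_right.trans hroots)),
    h₁.card_ker hφ, h₂.card_ker hψ]
  calc _ ≤ (sumDiffPoly W' A₁ B₁ A₂ B₂ c).roots.toFinset.card :=
        (Set.ncard_le_ncard hroots (Finset.finite_toSet _)).trans_eq (Set.ncard_coe_finset _)
    _ ≤ _ := (Multiset.toFinset_card_le _).trans ((card_roots' _).trans
        (natDegree_sumDiffPoly_le (le_max_left _ _) (le_max_right _ _) (le_max_left _ _)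
          (le_max_right _ _) c))

end IsIsogeny

end Parallelogram

section Torsion

lemma eq_sq_of_parallelogram_le {f : ℕ → ℕ} (h0 : f 0 = 0) (h1 : f 1 = 1)
    (hdouble : ∀ a, f (2 * a) = 4 * f a)
    (hpar : ∀ a b, 0 < a → 0 < b → f (a + 2 * b) + f a ≤ 2 * (f (a + b) + f b)) (n : ℕ) :
    f n = n ^ 2 := by
  have h2 : f 2 = 4 := (hdouble 1).trans (by rw [h1])
  -- Applied to `(2, n)` and combined with doubling, the inequality at `(n, 1)` is an equality.
  have hstep (n : ℕ) (hn : 0 < n) : f (n + 2) + f n = 2 * f (n + 1) + 2 := by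
    have hle := hpar n 1 hn one_pos
    have hge := hpar 2 n two_pos hn
    rw [show 2 + 2 * n = 2 * (n + 1) by ring, hdouble, add_comm 2 n, h2] at hge
    rw [h1, mul_one] at hle
    omega
  induction n using Nat.strong_induction_on with
  | _ n ih =>
    match n with
    | 0 => exact h0
    | 1 => exact h1
    | 2 => exact h2
    | n + 3 =>
      have h := hstep (n + 1) n.succ_pos
      rw [ih (n + 1) (by omega), ih (n + 1 + 1) (by omega)] at h
      have hsq : (n + 3) ^ 2 + (n + 1) ^ 2 = 2 * (n + 1 + 1) ^ 2 + 2 := by ring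
      exact Nat.add_right_cancel (h.trans hsq.symm)

lemma ker_nsmul_id {A : Type*} [AddCommGroup A] (n : ℕ) :
    (n • AddMonoidHom.id A).ker = AddSubgroup.torsionBy A (n : ℤ) := by
  ext a
  exact (natCast_zsmul a n).symm.congr_left

lemma card_torsionBy {L : Type*} [Field L] [DecidableEq L] [IsAlgClosed L] [CharZero L]
    (W : WeierstrassCurve L) [W.IsElliptic] (n : ℕ) :
    Nat.card (AddSubgroup.torsionBy W.toAffine.Point (n : ℤ)) = n ^ 2 := by
  rw [← ker_nsmul_id]
  have := infinite_point W
  have hmul {n : ℕ} (hn : n ≠ 0) : IsIsogeny L (n • AddMonoidHom.id W.toAffine.Point) :=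
    isIsogeny_id.nsmul hn
  refine eq_sq_of_parallelogram_le (f := fun n => Nat.card (n • AddMonoidHom.id _).ker)
    ?_ ?_ (fun a => ?_) (fun a b ha hb => ?_) n
  · simp only [zero_smul]
    exact (Nat.card_congr (Equiv.subtypeUnivEquiv fun P => rfl)).trans
      Nat.card_eq_zero_of_infinite
  · simp only [one_smul]
    exact AddSubgroup.card_eq_one.mpr rfl
  · have hcomp : (2 * a) • AddMonoidHom.id W.toAffine.Point =
        (a • AddMonoidHom.id _).comp (2 • AddMonoidHom.id _) := by
      ext P
      exact mul_nsmul P 2 a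
    simp only [hcomp, card_ker_comp _ (hmul two_ne_zero).surjective, ker_nsmul_id 2]
    rw [Nat.cast_ofNat, card_torsionBy_two]
  · have hadd : (a + 2 * b) • AddMonoidHom.id W.toAffine.Point =
        (a + b) • AddMonoidHom.id _ + b • AddMonoidHom.id _ := by
      rw [← add_smul, add_assoc, two_mul]
    have hsub : a • AddMonoidHom.id W.toAffine.Point =
        (a + b) • AddMonoidHom.id _ - b • AddMonoidHom.id _ := by
      rw [add_smul, add_sub_cancel_right]
    have hle := (hmul (n := a + b) (by omega)).card_ker_add_add_card_ker_sub_le (hmul hb.ne')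
      (hadd ▸ hmul (by omega)) (hsub ▸ hmul ha.ne')
    rwa [← hadd, ← hsub] at hle

end Torsion

/-! ### Cyclic subgroups of coprime orders -/

section Groups

variable {A B : Type*} [AddCommGroup A] [AddCommGroup B] {H K : AddSubgroup A} {f : A →+ B}

lemma nonempty_prod_addEquiv_sup (h : Disjoint H K) : Nonempty (H × K ≃+ ↥(H ⊔ K)) := by
  let f : H × K →+ A := H.subtype.coprod K.subtype
  have hinj : Function.Injective f := by
    refine (injective_iff_map_eq_zero f).mpr fun ⟨⟨x, hx⟩, ⟨y, hy⟩⟩ hxy => ?_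
    have hxy : x + y = 0 := hxy
    obtain rfl : y = 0 :=
      AddSubgroup.disjoint_def.mp h (eq_neg_of_add_eq_zero_right hxy ▸ H.neg_mem hx) hy
    exact Prod.ext (Subtype.ext ((add_zero x).symm.trans hxy)) rfl
  have hrange : f.range = H ⊔ K := by
    ext x
    simp [f, AddSubgroup.mem_sup]
  exact ⟨(AddMonoidHom.ofInjective hinj).trans (AddEquiv.addSubgroupCongr hrange)⟩

lemma card_sup_of_coprime (h : (Nat.card H).Coprime (Nat.card K)) :
    Nat.card ↥(H ⊔ K) = Nat.card H * Nat.card K := by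
  obtain ⟨e⟩ := nonempty_prod_addEquiv_sup (AddSubgroup.disjoint_of_coprime_natCard h)
  rw [← Nat.card_congr e.toEquiv, Nat.card_prod]

lemma isAddCyclic_sup_of_coprime (hH : IsAddCyclic H) (hK : IsAddCyclic K)
    (h : (Nat.card H).Coprime (Nat.card K)) : IsAddCyclic ↥(H ⊔ K) := by
  obtain ⟨e⟩ := nonempty_prod_addEquiv_sup (AddSubgroup.disjoint_of_coprime_natCard h)
  exact e.isAddCyclic.mp (AddGroup.isAddCyclic_prod_iff.mpr ⟨hH, hK, h⟩)

variable (H) in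
lemma le_torsionBy_card : H ≤ AddSubgroup.torsionBy A (Nat.card H : ℤ) := fun a ha =>
  (natCast_zsmul a _).trans (addOrderOf_dvd_iff_nsmul_eq_zero.mp (H.addOrderOf_dvd_natCard ha))

lemma sup_inf_torsionBy_card (h : (Nat.card H).Coprime (Nat.card K)) :
    (H ⊔ K) ⊓ AddSubgroup.torsionBy A (Nat.card H : ℤ) = H := by
  refine le_antisymm ?_ (le_inf le_sup_left (le_torsionBy_card H))
  rintro _ ⟨hxy, htors⟩
  obtain ⟨x, hx, y, hy, rfl⟩ := AddSubgroup.mem_sup.mp hxy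
  have hy' : y ∈ AddSubgroup.torsionBy A (Nat.card H : ℤ) := by
    simpa only [add_sub_cancel_left] using
      (AddSubgroup.torsionBy A _).sub_mem htors (le_torsionBy_card H hx)
  have hdvd : addOrderOf y ∣ Nat.card H :=
    addOrderOf_dvd_of_nsmul_eq_zero ((natCast_zsmul y _).symm.trans hy')
  have hy0 : y = 0 := AddMonoid.addOrderOf_eq_one_iff.mp
    (Nat.eq_one_of_dvd_coprimes h hdvd (K.addOrderOf_dvd_natCard hy))
  rwa [hy0, add_zero]

lemma zmultiples_eq_of_addOrderOf_eq_card {a : A} (ha : a ∈ H) (h : addOrderOf a = Nat.card H)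
    (h0 : Nat.card H ≠ 0) : AddSubgroup.zmultiples a = H := by
  have := Nat.finite_of_card_ne_zero h0
  exact AddSubgroup.eq_of_le_of_card_ge (AddSubgroup.zmultiples_le.mpr ha)
    (h.symm.trans (Nat.card_zmultiples a).symm).le

lemma isAddCyclic_of_addOrderOf_mul_eq_card {a b : A} (ha : a ∈ H) (hb : b ∈ H)
    (hcop : (addOrderOf a).Coprime (addOrderOf b))
    (h : addOrderOf a * addOrderOf b = Nat.card H) (h0 : Nat.card H ≠ 0) : IsAddCyclic H := by
  rw [← (AddCommute.all a b).addOrderOf_add_eq_mul_addOrderOf_of_coprime hcop] at h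
  rw [← zmultiples_eq_of_addOrderOf_eq_card (H.add_mem ha hb) h h0]
  infer_instance

lemma ker_eq_map_ker_comp (hf : Function.Surjective f) {C : Type*} [AddCommGroup C] (g : B →+ C) :
    g.ker = (g.comp f).ker.map f := by
  rw [← AddMonoidHom.comap_ker, AddSubgroup.map_comap_eq_self_of_surjective hf]

lemma ker_neg (f : A →+ B) : (-f).ker = f.ker := by
  ext a
  exact neg_eq_zero

lemma addOrderOf_map_of_coprime {a : A} (h : (addOrderOf a).Coprime (Nat.card f.ker)) :
    addOrderOf (f a) = addOrderOf a := by
  refine Nat.dvd_antisymm (addOrderOf_map_dvd f a) ?_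
  have hmem : addOrderOf (f a) • a ∈ f.ker := by
    rw [AddMonoidHom.mem_ker, map_nsmul, addOrderOf_nsmul_eq_zero]
  have hzero : (Nat.card f.ker * addOrderOf (f a)) • a = 0 := by
    rw [mul_nsmul']
    exact (natCast_zsmul _ _).symm.trans (le_torsionBy_card f.ker hmem)
  exact h.dvd_of_dvd_mul_left (addOrderOf_dvd_of_nsmul_eq_zero hzero)

lemma exists_map_eq_of_coprime (hf : Function.Surjective f) {b : B}
    (h : (addOrderOf b).Coprime (Nat.card f.ker)) : ∃ a, f a = b ∧ addOrderOf a = addOrderOf b := by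
  obtain ⟨a, rfl⟩ := hf b
  obtain ⟨u, v, huv⟩ := Nat.isCoprime_iff_coprime.mpr h
  have hb : (addOrderOf (f a) : ℤ) • f a = 0 := by rw [natCast_zsmul, addOrderOf_nsmul_eq_zero]
  have hmem : (addOrderOf (f a) : ℤ) • a ∈ f.ker := (map_zsmul f _ a).trans hb
  have hlift : f ((v * Nat.card f.ker) • a) = f a := by
    rw [map_zsmul, ← sub_eq_of_eq_add' huv.symm, sub_smul, one_smul, mul_smul, hb, smul_zero,
      sub_zero]
  refine ⟨(v * Nat.card f.ker) • a, hlift, Nat.dvd_antisymm ?_ ?_⟩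
  · refine addOrderOf_dvd_of_nsmul_eq_zero ?_
    have hzero : (Nat.card f.ker : ℤ) • (addOrderOf (f a) : ℤ) • a = 0 :=
      le_torsionBy_card f.ker hmem
    rw [← natCast_zsmul, smul_comm, mul_smul, hzero, smul_zero]
  · exact hlift ▸ addOrderOf_map_dvd f ((v * Nat.card f.ker) • a)

lemma addOrderOf_map_nsmul_mem_zmultiples {a : A} (h : addOrderOf a = Nat.card f.ker)
    (h0 : addOrderOf a ≠ 0) {b : A} (hb : b ∈ f.ker) :
    addOrderOf (f a) • b ∈ AddSubgroup.zmultiples a := by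
  set m := addOrderOf (f a)
  have hdvd : m ∣ addOrderOf a := addOrderOf_map_dvd f a
  have hle : AddSubgroup.zmultiples (m • a) ≤ f.ker := by
    rw [AddSubgroup.zmultiples_le, AddMonoidHom.mem_ker, map_nsmul, addOrderOf_nsmul_eq_zero]
  have hcard : Nat.card (AddSubgroup.zmultiples (m • a)) * m = addOrderOf a := by
    rw [Nat.card_zmultiples, addOrderOf_nsmul_of_dvd (ne_zero_of_dvd_ne_zero h0 hdvd) hdvd,
      Nat.div_mul_cancel hdvd]
  have hindex : (AddSubgroup.zmultiples (m • a)).relIndex f.ker = m := by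
    have hmul := AddSubgroup.relIndex_mul_relIndex ⊥ _ _ bot_le hle
    rw [AddSubgroup.relIndex_bot_left, AddSubgroup.relIndex_bot_left, ← h, ← hcard] at hmul
    exact Nat.eq_of_mul_eq_mul_left (Nat.pos_of_ne_zero (left_ne_zero_of_mul (hcard ▸ h0))) hmul
  have hmem : m • b ∈ AddSubgroup.zmultiples (m • a) := by
    simpa only [hindex] using
      (AddSubgroup.zmultiples (m • a)).nsmul_relIndex_mem hb
  exact AddSubgroup.zmultiples_le.mpr (nsmul_mem (AddSubgroup.mem_zmultiples a) m) hmem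

lemma addOrderOf_eq_sq_of_addOrderOf_nsmul_eq {a : A} {m : ℕ} (hm : m ≠ 0)
    (h : addOrderOf (m • a) = m) : addOrderOf a = m ^ 2 := by
  have hgcd : (addOrderOf a).gcd m * m = addOrderOf a := by
    nth_rw 2 [← h]
    rw [addOrderOf_nsmul' a hm, Nat.mul_div_cancel' (Nat.gcd_dvd_left _ _)]
  have hdvd : m ∣ addOrderOf a := ⟨_, hgcd.symm.trans (mul_comm _ _)⟩
  rw [← hgcd, Nat.gcd_eq_right hdvd, sq]

end Groups

/-! ### Dual isogenies and endomorphisms -/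

section Dual

variable {L : Type*} [Field L] [DecidableEq L] {W W' V : WeierstrassCurve L}
  {φ ψ : W.toAffine.Point →+ W'.toAffine.Point}

lemma IsIsogeny.card_ker_pos (hφ : IsIsogeny L φ) : 0 < Nat.card φ.ker :=
  have := hφ.finite_ker.to_subtype
  Nat.card_pos

variable [IsAlgClosed L] [CharZero L] [W.IsElliptic]

variable (W) in
lemma card_ker_zsmul_id (n : ℤ) :
    Nat.card (n • AddMonoidHom.id W.toAffine.Point).ker = n.natAbs ^ 2 := by
  have hker : (n • AddMonoidHom.id W.toAffine.Point).ker = AddSubgroup.torsionBy _ n.natAbs := by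
    ext P
    exact natAbs_nsmul_eq_zero.symm.trans (natCast_zsmul P n.natAbs).symm.congr_left
  rw [hker, card_torsionBy]

namespace IsIsogeny

lemma comp_left_cancel [W'.IsElliptic] {β : W'.toAffine.Point →+ V.toAffine.Point}
    (hβ : IsIsogeny L β) (hφ : IsIsogeny L φ) (hψ : IsIsogeny L ψ) (h : β.comp φ = β.comp ψ) :
    φ = ψ := by
  have := infinite_point W
  by_contra hne
  have hsub : IsIsogeny L (φ + -ψ) :=
    hφ.add hψ.neg (by rwa [← sub_eq_add_neg, sub_ne_zero])
  refine (hβ.comp hsub).ne_zero ?_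
  rw [AddMonoidHom.comp_add, AddMonoidHom.comp_neg, h, add_neg_cancel]

variable [W'.IsElliptic]

lemma exists_dual (hφ : IsIsogeny L φ) :
    ∃ ψ : W'.toAffine.Point →+ W.toAffine.Point, IsIsogeny L ψ ∧
      ψ.comp φ = Nat.card φ.ker • AddMonoidHom.id _ ∧ Nat.card ψ.ker = Nat.card φ.ker := by
  have hn := hφ.card_ker_pos
  have hker : φ.ker ≤ (Nat.card φ.ker • AddMonoidHom.id W.toAffine.Point).ker :=
    (le_torsionBy_card φ.ker).trans_eq (ker_nsmul_id _).symm
  obtain ⟨ψ, hψ, hcomp⟩ := hφ.exists_comp_eq (isIsogeny_id.nsmul hn.ne') hker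
  refine ⟨ψ, hψ, hcomp, Nat.eq_of_mul_eq_mul_left hn ?_⟩
  rw [← card_ker_comp ψ hφ.surjective, hcomp, ker_nsmul_id, card_torsionBy, sq]

end IsIsogeny

end Dual

section TrivialEndomorphisms

variable {L : Type*} [Field L] [DecidableEq L]

/-- Every isogeny from `W` to itself is multiplication by an integer. For the base change of `E`
to an algebraically closed field this is `IsNonCM`. -/
def HasTrivialEndomorphisms (W : WeierstrassCurve L) : Prop :=
  ∀ φ : W.toAffine.Point →+ W.toAffine.Point, IsIsogeny L φ →
    ∃ n : ℤ, φ = n • AddMonoidHom.id _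

lemma isNonCM_iff_hasTrivialEndomorphisms {K : Type*} [Field K] [Algebra K L]
    {E : WeierstrassCurve K} : IsNonCM L E ↔ HasTrivialEndomorphisms (E.baseChange L) :=
  forall₂_congr fun φ _ => exists_congr fun n =>
    (DFunLike.ext_iff (f := φ) (g := n • AddMonoidHom.id _)).symm

namespace HasTrivialEndomorphisms

variable [IsAlgClosed L] [CharZero L] {W V : WeierstrassCurve L} [W.IsElliptic] [V.IsElliptic]

lemma comp_eq_or_eq_neg (hW : HasTrivialEndomorphisms W)
    {μ : W.toAffine.Point →+ V.toAffine.Point} {ν : V.toAffine.Point →+ W.toAffine.Point}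
    (hμ : IsIsogeny L μ) (hν : IsIsogeny L ν) (h : Nat.card ν.ker = Nat.card μ.ker) :
    ν.comp μ = Nat.card μ.ker • AddMonoidHom.id _ ∨
      ν.comp μ = -(Nat.card μ.ker • AddMonoidHom.id _) := by
  obtain ⟨k, hk⟩ := hW _ (hν.comp hμ)
  have hsq : k.natAbs ^ 2 = Nat.card μ.ker ^ 2 := by
    rw [← card_ker_zsmul_id W, ← hk, card_ker_comp ν hμ.surjective, h, sq]
  rw [hk, ← Nat.pow_left_injective two_ne_zero hsq, ← natCast_zsmul, ← neg_zsmul]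
  exact (Int.natAbs_eq k).imp (congrArg (· • AddMonoidHom.id W.toAffine.Point))
    (congrArg (· • AddMonoidHom.id W.toAffine.Point))

lemma eq_or_eq_neg (hW : HasTrivialEndomorphisms W) {α β : W.toAffine.Point →+ V.toAffine.Point}
    (hα : IsIsogeny L α) (hβ : IsIsogeny L β) (h : Nat.card α.ker = Nat.card β.ker) :
    α = β ∨ α = -β := by
  obtain ⟨γ, hγ, hγβ, hcard⟩ := hβ.exists_dual
  refine (hW.comp_eq_or_eq_neg hα hγ (hcard.trans h.symm)).imp
    (fun hγα => hγ.comp_left_cancel hα hβ ?_) fun hγα => hγ.comp_left_cancel hα hβ.neg ?_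
  · rw [hγα, hγβ, h]
  · rw [hγα, AddMonoidHom.comp_neg, hγβ, h]

lemma of_isIsogeny (hW : HasTrivialEndomorphisms W) {φ : W.toAffine.Point →+ V.toAffine.Point}
    (hφ : IsIsogeny L φ) : HasTrivialEndomorphisms V := by
  intro χ hχ
  obtain ⟨ψ, hψ, hψφ, hcard⟩ := hφ.exists_dual
  obtain ⟨a, ha⟩ := hW _ (hψ.comp (hχ.comp hφ))
  have hdvd : Nat.card φ.ker ^ 2 ∣ a.natAbs ^ 2 := by
    rw [← card_ker_zsmul_id W, ← ha, card_ker_comp _ (hχ.comp hφ).surjective,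
      card_ker_comp _ hφ.surjective, hcard]
    exact ⟨Nat.card χ.ker, by ring⟩
  obtain ⟨b, rfl⟩ := Int.natCast_dvd.mpr ((Nat.pow_dvd_pow_iff two_ne_zero).mp hdvd)
  have := infinite_point W
  have hb : b ≠ 0 := by
    rintro rfl
    exact (hψ.comp (hχ.comp hφ)).ne_zero (by rw [ha, mul_zero]; exact zero_zsmul _)
  have hχφ : χ.comp φ = b • φ := by
    refine hψ.comp_left_cancel (hχ.comp hφ) (hφ.zsmul hb) (DFunLike.ext _ _ fun P => ?_)
    calc ψ (χ (φ P)) = ((Nat.card φ.ker : ℤ) * b) • P := DFunLike.congr_fun ha P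
      _ = b • ψ (φ P) := by
        rw [mul_comm, mul_smul, natCast_zsmul]
        exact congrArg (b • ·) (DFunLike.congr_fun hψφ P).symm
      _ = ψ (b • φ P) := (map_zsmul ψ b _).symm
  refine ⟨b, DFunLike.ext _ _ fun Q => ?_⟩
  obtain ⟨P, rfl⟩ := hφ.surjective Q
  exact DFunLike.congr_fun hχφ P

end HasTrivialEndomorphisms

end TrivialEndomorphisms

/-! ### Galois conjugation -/

section Conjugation

lemma aeval_map_apply {k L : Type*} [CommSemiring k] [CommSemiring L] [Algebra k L]
    (τ : L →+* L) (x y : L) (p : MvPolynomial (Fin 2) k) :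
    MvPolynomial.aeval ![τ x, τ y] (p.map (τ.comp (algebraMap k L))) =
      τ (MvPolynomial.aeval ![x, y] p) := by
  rw [MvPolynomial.aeval_def, MvPolynomial.eval₂_map, MvPolynomial.aeval_def,
    MvPolynomial.eval₂_comp_left τ (algebraMap k L)]
  congr 1
  ext i
  fin_cases i <;> rfl

variable {L : Type*} [Field L] [DecidableEq L] {W V W' V' : WeierstrassCurve L} {τ τ' : L ≃+* L}

lemma conjPoint_surjective (τ : L ≃+* L) (W : WeierstrassCurve L) :
    Function.Surjective (conjPoint (τ : L →+* L) W) := by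
  rintro (_ | ⟨x, y, hxy⟩)
  · exact ⟨0, rfl⟩
  · obtain ⟨x, rfl⟩ := τ.surjective x
    obtain ⟨y, rfl⟩ := τ.surjective y
    exact ⟨.some x y ((Affine.map_nonsingular W.toAffine τ.injective x y).mp hxy), rfl⟩

/-- The conjugation isomorphism `(x, y) ↦ (τ x, τ y)` from `W` to a curve `V` equal to `W^τ`. The
equation `W^τ = V` is an argument because for curves over a subfield it is not definitional. -/
noncomputable def conjEquiv (τ : L ≃+* L) :
    ∀ {V : WeierstrassCurve L}, W.map (τ : L →+* L) = V → W.toAffine.Point ≃+ V.toAffine.Point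
  | _, rfl => AddEquiv.ofBijective (conjPoint (τ : L →+* L) W)
      ⟨LevelPair.conjPoint_injective _ W, conjPoint_surjective τ W⟩

lemma xCoord_conjEquiv (h : W.map (τ : L →+* L) = V) (P : W.toAffine.Point) :
    xCoord (conjEquiv τ h P) = τ (xCoord P) := by
  subst h
  rcases P with _ | _
  · exact (map_zero τ).symm
  · rfl

lemma yCoord_conjEquiv (h : W.map (τ : L →+* L) = V) (P : W.toAffine.Point) :
    yCoord (conjEquiv τ h P) = τ (yCoord P) := by
  subst h
  rcases P with _ | _
  · exact (map_zero τ).symm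
  · rfl

/-- The conjugate `φ^τ = τ ∘ φ ∘ τ⁻¹ : V → V'` of `φ : W → W'`, for `V = W^τ` and `V' = W'^τ`. -/
noncomputable def conjMap (τ : L ≃+* L) (h : W.map (τ : L →+* L) = V)
    (h' : W'.map (τ : L →+* L) = V') (φ : W.toAffine.Point →+ W'.toAffine.Point) :
    V.toAffine.Point →+ V'.toAffine.Point :=
  (conjEquiv τ h').toAddMonoidHom.comp (φ.comp (conjEquiv τ h).symm.toAddMonoidHom)

variable (h : W.map (τ : L →+* L) = V) (h' : W'.map (τ : L →+* L) = V')
  {φ : W.toAffine.Point →+ W'.toAffine.Point}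

lemma conjMap_conjEquiv (φ : W.toAffine.Point →+ W'.toAffine.Point) (P : W.toAffine.Point) :
    conjMap τ h h' φ (conjEquiv τ h P) = conjEquiv τ h' (φ P) :=
  congrArg (fun Q => conjEquiv τ h' (φ Q)) ((conjEquiv τ h).symm_apply_apply P)

lemma ker_conjMap (φ : W.toAffine.Point →+ W'.toAffine.Point) :
    (conjMap τ h h' φ).ker = φ.ker.map (conjEquiv τ h).toAddMonoidHom := by
  ext Q
  obtain ⟨P, rfl⟩ := (conjEquiv τ h).surjective Q
  rw [AddMonoidHom.mem_ker, conjMap_conjEquiv, EmbeddingLike.map_eq_zero_iff]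
  exact (AddSubgroup.mem_map_iff_mem (f := (conjEquiv τ h).toAddMonoidHom) (K := φ.ker)
    (conjEquiv τ h).injective).symm

lemma card_ker_conjMap (φ : W.toAffine.Point →+ W'.toAffine.Point) :
    Nat.card (conjMap τ h h' φ).ker = Nat.card φ.ker := by
  rw [ker_conjMap]
  exact AddSubgroup.card_map_of_injective (conjEquiv τ h).injective

lemma HasCyclicKernel.conjMap {n : ℕ} (hφ : HasCyclicKernel φ n) :
    HasCyclicKernel (conjMap τ h h' φ) n := by
  have := hφ.1
  refine ⟨?_, (card_ker_conjMap h h' φ).trans hφ.2⟩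
  rw [ker_conjMap]
  exact isAddCyclic_of_surjective _
    (φ.ker.equivMapOfInjective _ (conjEquiv τ h).injective).surjective

variable {k : Type*} [Field k] [Algebra k L]

lemma IsGivenBy.conjMap {a b c : MvPolynomial (Fin 2) k} (hφ : IsGivenBy φ a b c) :
    IsGivenBy (conjMap τ h h' φ) (a.map ((τ : L →+* L).comp (algebraMap k L)))
      (b.map ((τ : L →+* L).comp (algebraMap k L)))
      (c.map ((τ : L →+* L).comp (algebraMap k L))) := by
  filter_upwards [eventually_forall_of_map_eq hφ (conjEquiv τ h)] with Q hQ
  obtain ⟨P, rfl⟩ := (conjEquiv τ h).surjective Q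
  obtain ⟨hP, hφP, hc, hx, hy⟩ := hQ P rfl
  have hval : ∀ p : MvPolynomial (Fin 2) k,
      MvPolynomial.aeval ![xCoord (conjEquiv τ h P), yCoord (conjEquiv τ h P)]
        (p.map ((τ : L →+* L).comp (algebraMap k L))) =
      τ (MvPolynomial.aeval ![xCoord P, yCoord P] p) := fun p => by
    rw [xCoord_conjEquiv, yCoord_conjEquiv]
    exact aeval_map_apply (τ : L →+* L) _ _ p
  rw [conjMap_conjEquiv, hval, hval, hval, xCoord_conjEquiv, yCoord_conjEquiv, hx, hy, map_div₀,
    map_div₀]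
  exact ⟨EmbeddingLike.map_ne_zero_iff.mpr hP, EmbeddingLike.map_ne_zero_iff.mpr hφP,
    EmbeddingLike.map_ne_zero_iff.mpr hc, rfl, rfl⟩

namespace IsIsogeny

lemma conjMap (hφ : IsIsogeny L φ) : IsIsogeny L (conjMap τ h h' φ) := by
  obtain ⟨a, b, c, hφ⟩ := isIsogeny_iff_exists_isGivenBy.mp hφ
  exact isIsogeny_iff_exists_isGivenBy.mpr ⟨_, _, _, hφ.conjMap h h'⟩

lemma conjMap_eq_conjMap [Infinite V.toAffine.Point] (hφ : IsIsogeny k φ)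
    (hτ : (τ : L →+* L).comp (algebraMap k L) = (τ' : L →+* L).comp (algebraMap k L))
    (g : W.map (τ' : L →+* L) = V) (g' : W'.map (τ' : L →+* L) = V') :
    QuadQCurve.conjMap τ h h' φ = QuadQCurve.conjMap τ' g g' φ := by
  obtain ⟨a, b, c, hφ⟩ := isIsogeny_iff_exists_isGivenBy.mp hφ
  have hφ' := hφ.conjMap g g'
  rw [← hτ] at hφ'
  exact (hφ.conjMap h h').unique hφ'

lemma conjMap_eq_self [Infinite W.toAffine.Point] (hφ : IsIsogeny k φ)
    (hτ : (τ : L →+* L).comp (algebraMap k L) = algebraMap k L)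
    (h : W.map (τ : L →+* L) = W) (h' : W'.map (τ : L →+* L) = W') :
    QuadQCurve.conjMap τ h h' φ = φ := by
  obtain ⟨a, b, c, hφ⟩ := isIsogeny_iff_exists_isGivenBy.mp hφ
  have hφ' := hφ.conjMap h h'
  rw [hτ] at hφ'
  exact hφ'.unique hφ.baseChange

end IsIsogeny

end Conjugation

section LevelPairs

variable {L : Type*} [Field L] [DecidableEq L] {n : ℕ}

lemma exists_addEquiv_of_eq [CharZero L] {W V : WeierstrassCurve L} (h : W = V) :
    ∃ e : W.toAffine.Point ≃+ V.toAffine.Point, IsIsogeny L e.toAddMonoidHom ∧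
      IsIsogeny L e.symm.toAddMonoidHom ∧
      ∀ {U : WeierstrassCurve L} {τ : L ≃+* L} (hU : U.map (τ : L →+* L) = W),
        e.toAddMonoidHom.comp (conjEquiv τ hU).toAddMonoidHom =
          (conjEquiv τ (hU.trans h)).toAddMonoidHom := by
  subst h
  exact ⟨.refl _, isIsogeny_id, isIsogeny_id, fun _ => rfl⟩

namespace LevelPair

lemma iso_conj_of_map_eq [CharZero L] (x : LevelPair L n) {τ : L ≃+* L}
    (h : x.curve.map (τ : L →+* L) = x.curve)
    (hsub : x.subgroup.map (conjEquiv τ h).toAddMonoidHom = x.subgroup) :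
    (x.conj (τ : L →+* L)).Iso x := by
  obtain ⟨e, he, he', hcomp⟩ := exists_addEquiv_of_eq h
  refine ⟨e, he, he', ?_⟩
  calc (x.subgroup.map (conjEquiv τ rfl).toAddMonoidHom).map e.toAddMonoidHom
      = x.subgroup.map (conjEquiv τ h).toAddMonoidHom := by rw [AddSubgroup.map_map, hcomp]
    _ = x.subgroup := hsub

lemma isAtkinLehnerImage_conj (x : LevelPair L n) {τ : L ≃+* L} {V : WeierstrassCurve L}
    (h : x.curve.map (τ : L →+* L) = V) {d : ℕ}
    {μ : x.curve.toAffine.Point →+ V.toAffine.Point} (hμ : IsIsogeny L μ)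
    (hker : μ.ker = x.subgroup ⊓ AddSubgroup.torsionBy x.curve.toAffine.Point (d : ℤ))
    (hsub : x.subgroup.map (conjEquiv τ h).toAddMonoidHom =
      (AddSubgroup.torsionBy x.curve.toAffine.Point (d : ℤ)).map μ ⊔
        (x.subgroup ⊓
          AddSubgroup.torsionBy x.curve.toAffine.Point ((n / d : ℕ) : ℤ)).map μ) :
    x.IsAtkinLehnerImage d (x.conj (τ : L →+* L)) := by
  subst h
  exact ⟨μ, hμ, hker, hsub⟩

end LevelPair

end LevelPairs

/-! ### Rational points from isogenies between conjugate curves -/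

section Rationality

variable {L : Type*} [Field L] [DecidableEq L] [IsAlgClosed L] [CharZero L]
  {W V : WeierstrassCurve L} [W.IsElliptic] [V.IsElliptic]

namespace HasTrivialEndomorphisms

variable (hW : HasTrivialEndomorphisms W)
include hW

lemma ker_eq_of_card_ker_eq {α β : W.toAffine.Point →+ V.toAffine.Point} (hα : IsIsogeny L α)
    (hβ : IsIsogeny L β) (h : Nat.card α.ker = Nat.card β.ker) : α.ker = β.ker := by
  obtain rfl | rfl := hW.eq_or_eq_neg hα hβ h
  · rfl
  · exact ker_neg β

lemma ker_eq_map_torsionBy {μ : W.toAffine.Point →+ V.toAffine.Point}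
    {ν : V.toAffine.Point →+ W.toAffine.Point} (hμ : IsIsogeny L μ) (hν : IsIsogeny L ν)
    (h : Nat.card ν.ker = Nat.card μ.ker) :
    ν.ker = (AddSubgroup.torsionBy W.toAffine.Point (Nat.card μ.ker : ℤ)).map μ := by
  rw [ker_eq_map_ker_comp hμ.surjective, ← ker_nsmul_id]
  obtain hcomp | hcomp := hW.comp_eq_or_eq_neg hμ hν h
  · rw [hcomp]
  · rw [hcomp, ker_neg]

lemma exists_isRationalModAtkinLehner {μ : W.toAffine.Point →+ V.toAffine.Point}
    (hμ : IsIsogeny L μ) {d : ℕ} (hμd : HasCyclicKernel μ d) {C : AddSubgroup W.toAffine.Point}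
    (hC : IsAddCyclic C) (hcop : d.Coprime (Nat.card C))
    (hconj : ∀ τ : L ≃ₐ[ℚ] L,
      (∃ (h : W.map (τ.toRingEquiv : L →+* L) = W) (_ : V.map (τ.toRingEquiv : L →+* L) = V),
        C.map (conjEquiv τ.toRingEquiv h).toAddMonoidHom = C) ∨
      ∃ (h : W.map (τ.toRingEquiv : L →+* L) = V) (_ : V.map (τ.toRingEquiv : L →+* L) = W),
        C.map (conjEquiv τ.toRingEquiv h).toAddMonoidHom = C.map μ) :
    ∃ x : LevelPair L (Nat.card C * d), x.curve = W ∧ x.IsRationalModAtkinLehner d := by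
  obtain ⟨hcyc, rfl⟩ := hμd
  let x : LevelPair L (Nat.card C * Nat.card μ.ker) :=
    ⟨W, inferInstance, μ.ker ⊔ C, isAddCyclic_sup_of_coprime hcyc hC hcop,
      (card_sup_of_coprime hcop).trans (mul_comm _ _)⟩
  refine ⟨x, rfl, fun τ => (hconj τ).imp ?_ ?_⟩
  · rintro ⟨h, h', hfix⟩
    refine x.iso_conj_of_map_eq h ?_
    calc (μ.ker ⊔ C).map (conjEquiv τ.toRingEquiv h).toAddMonoidHom
        = (conjMap τ.toRingEquiv h h' μ).ker ⊔ C := by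
          rw [AddSubgroup.map_sup, ker_conjMap, hfix]
      _ = μ.ker ⊔ C := by
          rw [hW.ker_eq_of_card_ker_eq (hμ.conjMap h h') hμ (card_ker_conjMap h h' μ)]
  · rintro ⟨h, h', hswap⟩
    refine x.isAtkinLehnerImage_conj h hμ (sup_inf_torsionBy_card hcop).symm ?_
    rw [Nat.mul_div_cancel _ hμ.card_ker_pos]
    calc (μ.ker ⊔ C).map (conjEquiv τ.toRingEquiv h).toAddMonoidHom
        = (conjMap τ.toRingEquiv h h' μ).ker ⊔ C.map μ := by
          rw [AddSubgroup.map_sup, ker_conjMap, hswap]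
      _ = (AddSubgroup.torsionBy _ (Nat.card μ.ker : ℤ)).map μ ⊔
            ((μ.ker ⊔ C) ⊓ AddSubgroup.torsionBy _ (Nat.card C : ℤ)).map μ := by
          rw [hW.ker_eq_map_torsionBy hμ (hμ.conjMap h h') (card_ker_conjMap h h' μ),
            sup_comm μ.ker, sup_inf_torsionBy_card hcop.symm]

end HasTrivialEndomorphisms

end Rationality

/-! ### Quadratic fields -/

section QuadraticField

lemma map_baseChange_of_comp_eq {K L : Type*} [Field K] [Field L] [Algebra K L]
    (E : WeierstrassCurve K) {τ : L →+* L} {σ : K →+* K}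
    (h : τ.comp (algebraMap K L) = (algebraMap K L).comp σ) :
    (E.baseChange L).map τ = (E.map σ).baseChange L := by
  simp only [WeierstrassCurve.baseChange, WeierstrassCurve.map_map, h]

lemma map_baseChange_of_comp_eq_self {K L : Type*} [Field K] [Field L] [Algebra K L]
    (E : WeierstrassCurve K) {τ : L →+* L} (h : τ.comp (algebraMap K L) = algebraMap K L) :
    (E.baseChange L).map τ = E.baseChange L := by
  rw [map_baseChange_of_comp_eq E (σ := RingHom.id K) h, E.map_id]

variable {K : Type*} [Field K] [NumberField K]

lemma card_algEquiv_of_finrank_eq_two (hK : Module.finrank ℚ K = 2) :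
    Nat.card (K ≃ₐ[ℚ] K) = 2 := by
  have : Algebra.IsQuadraticExtension ℚ K := ⟨hK⟩
  rw [IsGalois.card_aut_eq_finrank, hK]

lemma eq_one_or_eq_of_finrank_eq_two (hK : Module.finrank ℚ K = 2) {σ : K ≃ₐ[ℚ] K} (hσ : σ ≠ 1)
    (ρ : K ≃ₐ[ℚ] K) : ρ = 1 ∨ ρ = σ :=
  or_iff_not_imp_left.mpr fun hρ =>
    ((Nat.card_eq_two_iff' 1).mp (card_algEquiv_of_finrank_eq_two hK)).unique hρ hσ

lemma comp_self_eq_id_of_finrank_eq_two (hK : Module.finrank ℚ K = 2) (σ : K ≃ₐ[ℚ] K) :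
    (σ : K →+* K).comp (σ : K →+* K) = RingHom.id K := by
  have hsq : σ ^ 2 = 1 := card_algEquiv_of_finrank_eq_two hK ▸ pow_card_eq_one'
  exact RingHom.ext fun a => DFunLike.congr_fun ((sq σ).symm.trans hsq) a

variable {L : Type*} [Field L] [CharZero L] [Algebra K L]

lemma comp_algebraMap_eq_or_eq (hK : Module.finrank ℚ K = 2) {σ : K ≃ₐ[ℚ] K} (hσ : σ ≠ 1)
    (τ : L ≃ₐ[ℚ] L) :
    (τ.toRingEquiv : L →+* L).comp (algebraMap K L) = algebraMap K L ∨
      (τ.toRingEquiv : L →+* L).comp (algebraMap K L) =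
        (algebraMap K L).comp (σ : K →+* K) := by
  have : Algebra.IsQuadraticExtension ℚ K := ⟨hK⟩
  have hcomm (a : K) : τ (algebraMap K L a) = algebraMap K L (τ.restrictNormal K a) :=
    (τ.restrictNormal_commutes K a).symm
  refine (eq_one_or_eq_of_finrank_eq_two hK hσ (τ.restrictNormal K)).imp ?_ ?_ <;>
    exact fun h => RingHom.ext fun a => (hcomm a).trans (by rw [h]; rfl)

lemma exists_comp_algebraMap_eq [IsAlgClosure K L] (σ : K ≃ₐ[ℚ] K) :
    ∃ τ : L ≃ₐ[ℚ] L, (τ.toRingEquiv : L →+* L).comp (algebraMap K L) =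
      (algebraMap K L).comp (σ : K →+* K) := by
  have : IsAlgClosed L := IsAlgClosure.isAlgClosed K
  have : Algebra.IsAlgebraic K L := IsAlgClosure.isAlgebraic
  have : Algebra.IsAlgebraic ℚ L := Algebra.IsAlgebraic.trans ℚ K L
  have : IsAlgClosure ℚ L := ⟨inferInstance, inferInstance⟩
  have : Normal ℚ L := IsAlgClosure.normal ℚ L
  exact ⟨σ.liftNormal L, RingHom.ext (σ.liftNormal_commutes L)⟩

end QuadraticField

section QuadraticPoints

variable {K : Type*} [Field K] {L : Type*} [Field L] [DecidableEq L] [CharZero L] [Algebra K L]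
  {E : WeierstrassCurve K} [E.IsElliptic]

instance isElliptic_baseChange : (E.baseChange L).IsElliptic :=
  inferInstanceAs (E.map (algebraMap K L)).IsElliptic

lemma correspondsToRationalPoint_of_curve_eq {n d : ℕ} {x : LevelPair L n}
    (hx : x.curve = E.baseChange L) (h : x.IsRationalModAtkinLehner d) :
    CorrespondsToRationalPoint L E n d := by
  obtain ⟨W, _, C, hC, hcard⟩ := x
  obtain rfl : W = E.baseChange L := hx
  exact ⟨_, h, Or.inl (E.map_j (algebraMap K L)).symm⟩

variable [IsAlgClosed L] [NumberField K] {σ : K ≃ₐ[ℚ] K} (hK : Module.finrank ℚ K = 2)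
  (hCM : IsNonCM L E)
include hK hCM

lemma correspondsToRationalPoint_of_cyclic_subgroup (hσ : σ ≠ 1)
    {μ : (E.baseChange L).toAffine.Point →+ ((E.map (σ : K →+* K)).baseChange L).toAffine.Point}
    (hμ : IsIsogeny L μ) {d : ℕ} (hμd : HasCyclicKernel μ d)
    {C : AddSubgroup (E.baseChange L).toAffine.Point} (hC : IsAddCyclic C)
    (hcop : d.Coprime (Nat.card C))
    (hfix : ∀ (τ : L ≃+* L) (h : (E.baseChange L).map (τ : L →+* L) = E.baseChange L),
      (τ : L →+* L).comp (algebraMap K L) = algebraMap K L →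
        C.map (conjEquiv τ h).toAddMonoidHom = C)
    (hswap : ∀ (τ : L ≃+* L)
      (h : (E.baseChange L).map (τ : L →+* L) = (E.map (σ : K →+* K)).baseChange L),
      (τ : L →+* L).comp (algebraMap K L) = (algebraMap K L).comp (σ : K →+* K) →
        C.map (conjEquiv τ h).toAddMonoidHom = C.map μ) :
    CorrespondsToRationalPoint L E (Nat.card C * d) d := by
  have hCM' := isNonCM_iff_hasTrivialEndomorphisms.mp hCM
  obtain ⟨x, hx, hrat⟩ := hCM'.exists_isRationalModAtkinLehner hμ hμd hC hcop fun τ => by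
    refine (comp_algebraMap_eq_or_eq hK hσ τ).imp (fun hτ => ?_) fun hτ => ?_
    · exact ⟨map_baseChange_of_comp_eq_self E hτ, map_baseChange_of_comp_eq_self _ hτ,
        hfix _ _ hτ⟩
    · refine ⟨map_baseChange_of_comp_eq E hτ, ?_, hswap _ _ hτ⟩
      rw [map_baseChange_of_comp_eq _ hτ, WeierstrassCurve.map_map,
        comp_self_eq_id_of_finrank_eq_two hK, E.map_id]
  exact correspondsToRationalPoint_of_curve_eq hx hrat

lemma correspondsToRationalPointPlus_of_isQCurveOfDegree {n : ℕ} (h : IsQCurveOfDegree L E n) :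
    CorrespondsToRationalPointPlus L E n := by
  obtain ⟨σ, hσ, μ, hμ, hμn⟩ := h
  have hpoint := correspondsToRationalPoint_of_cyclic_subgroup (C := ⊥) hK hCM hσ hμ hμn
    inferInstance (by rw [AddSubgroup.card_bot]; exact n.coprime_one_right)
    (fun _ _ _ => AddSubgroup.map_bot _)
    fun _ _ _ => (AddSubgroup.map_bot _).trans (AddSubgroup.map_bot μ).symm
  rwa [AddSubgroup.card_bot, one_mul] at hpoint

lemma correspondsToRationalPoint_of_map_ker_eq (hσ : σ ≠ 1)
    {μ : (E.baseChange L).toAffine.Point →+ ((E.map (σ : K →+* K)).baseChange L).toAffine.Point}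
    (hμ : IsIsogeny L μ) {d : ℕ} (hμd : HasCyclicKernel μ d) {E' : WeierstrassCurve K}
    {φ : (E.baseChange L).toAffine.Point →+ (E'.baseChange L).toAffine.Point}
    (hφ : IsIsogeny K φ) {m : ℕ} (hφm : HasCyclicKernel φ m) (hcop : d.Coprime m)
    {τ₀ : L ≃+* L}
    (hτ₀ : (τ₀ : L →+* L).comp (algebraMap K L) = (algebraMap K L).comp (σ : K →+* K))
    (hmap : φ.ker.map μ =
      φ.ker.map (conjEquiv τ₀ (map_baseChange_of_comp_eq E hτ₀)).toAddMonoidHom) :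
    CorrespondsToRationalPoint L E (m * d) d := by
  obtain ⟨hcyc, rfl⟩ := hφm
  refine correspondsToRationalPoint_of_cyclic_subgroup hK hCM hσ hμ hμd hcyc hcop
    (fun τ h hτ => ?_) fun τ h hτ => ?_
  · have := infinite_point (E.baseChange L)
    rw [← ker_conjMap h (map_baseChange_of_comp_eq_self E' hτ) φ, hφ.conjMap_eq_self hτ]
  · have := infinite_point ((E.map (σ : K →+* K)).baseChange L)
    rw [hmap, ← ker_conjMap _ (map_baseChange_of_comp_eq E' hτ),
      ← ker_conjMap _ (map_baseChange_of_comp_eq E' hτ₀),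
      hφ.conjMap_eq_conjMap _ _ (hτ.trans hτ₀.symm)]

end QuadraticPoints

/-! ### Cyclic isogenies between the targets of an isogeny and its conjugate -/

section Targets

variable {L : Type*} [Field L] [DecidableEq L] [IsAlgClosed L] [CharZero L]
  {W V W' V' : WeierstrassCurve L} [W.IsElliptic] [V.IsElliptic] [W'.IsElliptic]
  {μ : W.toAffine.Point →+ V.toAffine.Point} {φ : W.toAffine.Point →+ W'.toAffine.Point}
  {φ₀ : V.toAffine.Point →+ V'.toAffine.Point} {d : ℕ}

lemma exists_isIsogeny_comp_eq (hμ : IsIsogeny L μ) (hφ : IsIsogeny L φ) (hφ₀ : IsIsogeny L φ₀)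
    {m : ℕ} (hm : m ≠ 0)
    (hker : φ.ker ≤ (φ₀.comp (μ.comp (m • AddMonoidHom.id _))).ker)
    (hcard : Nat.card φ₀.ker = Nat.card φ.ker) :
    ∃ ψ : W'.toAffine.Point →+ V'.toAffine.Point, IsIsogeny L ψ ∧
      (∀ P, ψ (φ P) = φ₀ (μ (m • P))) ∧ Nat.card ψ.ker = m ^ 2 * Nat.card μ.ker := by
  have hmul : IsIsogeny L (m • AddMonoidHom.id W.toAffine.Point) := isIsogeny_id.nsmul hm
  obtain ⟨ψ, hψ, hcomp⟩ := hφ.exists_comp_eq (hφ₀.comp (hμ.comp hmul)) hker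
  refine ⟨ψ, hψ, DFunLike.congr_fun hcomp, Nat.eq_of_mul_eq_mul_left hφ.card_ker_pos ?_⟩
  rw [← card_ker_comp ψ hφ.surjective, hcomp, card_ker_comp φ₀ (hμ.comp hmul).surjective,
    card_ker_comp μ hmul.surjective, ker_nsmul_id, card_torsionBy, hcard, mul_comm]

lemma exists_hasCyclicKernel_sq_mul {N : ℕ} (hμ : IsIsogeny L μ) (hμd : HasCyclicKernel μ d)
    (hφ : IsIsogeny L φ) (hφN : Nat.card φ.ker = N) (hφ₀ : IsIsogeny L φ₀)
    (hφ₀N : Nat.card φ₀.ker = N) {e : W.toAffine.Point} (he : addOrderOf e = N)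
    (hμe : μ e ∈ φ₀.ker) (hcop : d.Coprime N) :
    ∃ ψ : W'.toAffine.Point →+ V'.toAffine.Point, IsIsogeny L ψ ∧
      HasCyclicKernel ψ (addOrderOf (φ e) ^ 2 * d) := by
  obtain ⟨hcyc, rfl⟩ := hμd
  set m := addOrderOf (φ e)
  have hN : N ≠ 0 := hφN ▸ hφ.card_ker_pos.ne'
  have hmN : m ∣ N := he ▸ addOrderOf_map_dvd φ e
  have hm0 : m ≠ 0 := ne_zero_of_dvd_ne_zero hN hmN
  have hker : φ.ker ≤ (φ₀.comp (μ.comp (m • AddMonoidHom.id _))).ker := fun P hP => by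
    have hmP := addOrderOf_map_nsmul_mem_zmultiples (he.trans hφN.symm) (he ▸ hN) hP
    exact (AddSubgroup.zmultiples_le (H := (φ₀.comp μ).ker)).mpr hμe hmP
  obtain ⟨ψ, hψ, hψφ, hcard⟩ := exists_isIsogeny_comp_eq hμ hφ hφ₀ hm0 hker (hφ₀N.trans hφN.symm)
  refine ⟨ψ, hψ, ?_, hcard⟩
  obtain ⟨a, ha⟩ := (AddSubgroup.isAddCyclic_iff_exists_zmultiples_eq_top _).mp hcyc
  have haμ : addOrderOf a = Nat.card μ.ker := by rw [← ha, Nat.card_zmultiples]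
  have haφ : addOrderOf (φ a) = Nat.card μ.ker := by
    rw [addOrderOf_map_of_coprime (by rwa [haμ, hφN]), haμ]
  obtain ⟨Q, hQ⟩ : ∃ Q, m • Q = e := (isIsogeny_id.nsmul hm0).surjective e
  have hQφ : addOrderOf (φ Q) = m ^ 2 :=
    addOrderOf_eq_sq_of_addOrderOf_nsmul_eq hm0 (by rw [← map_nsmul, hQ])
  refine isAddCyclic_of_addOrderOf_mul_eq_card (a := φ a) (b := φ Q) ?_ ?_ ?_ ?_
    hψ.card_ker_pos.ne'
  · have : μ a = 0 := (ha ▸ AddSubgroup.mem_zmultiples a : a ∈ μ.ker)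
    rw [AddMonoidHom.mem_ker, hψφ, map_nsmul, this, nsmul_zero, map_zero]
  · rw [AddMonoidHom.mem_ker, hψφ]
    exact hQ ▸ hμe
  · rw [haφ, hQφ]
    exact (hcop.coprime_dvd_right hmN).pow_right 2
  · rw [haφ, hQφ, hcard, mul_comm]

lemma exists_dvd_and_hasCyclicKernel_sq_mul {N : ℕ} (hμ : IsIsogeny L μ)
    (hμd : HasCyclicKernel μ d) (hφ : IsIsogeny L φ) (hφN : Nat.card φ.ker = N)
    (hφ₀ : IsIsogeny L φ₀) (hφ₀N : HasCyclicKernel φ₀ N) (hcop : d.Coprime N) :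
    ∃ m, m ∣ N ∧ (m = 1 → φ.ker.map μ = φ₀.ker) ∧
      ∃ ψ : W'.toAffine.Point →+ V'.toAffine.Point, IsIsogeny L ψ ∧
        HasCyclicKernel ψ (m ^ 2 * d) := by
  obtain ⟨b, hb⟩ := (AddSubgroup.isAddCyclic_iff_exists_zmultiples_eq_top _).mp hφ₀N.1
  have hbN : addOrderOf b = N := by rw [← hφ₀N.2, ← hb, Nat.card_zmultiples]
  obtain ⟨e, rfl, he⟩ := exists_map_eq_of_coprime hμ.surjective (b := b)
    (by rw [hbN, hμd.2]; exact hcop.symm)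
  rw [hbN] at he
  refine ⟨addOrderOf (φ e), he ▸ addOrderOf_map_dvd φ e, fun hm => ?_,
    exists_hasCyclicKernel_sq_mul hμ hμd hφ hφN hφ₀ hφ₀N.2 he
      (hb ▸ AddSubgroup.mem_zmultiples (μ e)) hcop⟩
  rw [← hb, ← zmultiples_eq_of_addOrderOf_eq_card (AddMonoid.addOrderOf_eq_one_iff.mp hm)
    (he.trans hφN.symm) hφ.card_ker_pos.ne', AddMonoidHom.map_zmultiples]

end Targets

end QuadQCurve

theorem mainTheorem6_general {K : Type*} [Field K] [NumberField K] (hK : Module.finrank ℚ K = 2)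
    {L : Type*} [Field L] [DecidableEq L] [CharZero L] [Algebra K L] [IsAlgClosure K L]
    (E : WeierstrassCurve K) [E.IsElliptic] (hCM : QuadQCurve.IsNonCM L E) (d n : ℕ)
    (hcop : d.Coprime n) (hQ : QuadQCurve.IsQCurveOfDegree L E d)
    (hn : QuadQCurve.HasCyclicIsogeny L E n) :
    QuadQCurve.CorrespondsToRationalPoint L E (n * d) d ∨
      ∃ m, m ∣ n ∧ m ≠ 1 ∧ ∃ (F : WeierstrassCurve K) (_ : F.IsElliptic),
        QuadQCurve.IsogenousOver L E F ∧
          QuadQCurve.CorrespondsToRationalPointPlus L F (m ^ 2 * d) := by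
  have : IsAlgClosed L := IsAlgClosure.isAlgClosed K
  obtain ⟨σ, hσ, μ, hμ, hμd⟩ := hQ
  obtain ⟨E', _, φ, hφ, hφn⟩ := hn
  obtain ⟨τ, hτ⟩ := QuadQCurve.exists_comp_algebraMap_eq (L := L) σ
  have hE := QuadQCurve.map_baseChange_of_comp_eq E hτ
  have hE' := QuadQCurve.map_baseChange_of_comp_eq E' hτ
  obtain ⟨m, hm, hker, ψ, hψ, hψcyc⟩ := QuadQCurve.exists_dvd_and_hasCyclicKernel_sq_mul hμ hμd
    hφ.baseChange hφn.2 (hφ.baseChange.conjMap hE hE') (hφn.conjMap hE hE') hcop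
  by_cases hm1 : m = 1
  · exact .inl (QuadQCurve.correspondsToRationalPoint_of_map_ker_eq hK hCM hσ hμ hμd hφ hφn hcop
      hτ ((hker hm1).trans (QuadQCurve.ker_conjMap hE hE' φ)))
  · have hCM' : QuadQCurve.IsNonCM L E' := QuadQCurve.isNonCM_iff_hasTrivialEndomorphisms.mpr
      ((QuadQCurve.isNonCM_iff_hasTrivialEndomorphisms.mp hCM).of_isIsogeny hφ.baseChange)
    exact .inr ⟨m, hm, hm1, E', inferInstance, ⟨φ, hφ⟩,
      QuadQCurve.correspondsToRationalPointPlus_of_isQCurveOfDegree hK hCM'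
        ⟨σ, hσ, ψ, hψ, hψcyc⟩⟩

theorem mainTheorem6 {K : Type*} [Field K] [NumberField K] (hK : Module.finrank ℚ K = 2)
    {L : Type*} [Field L] [DecidableEq L] [CharZero L] [Algebra K L] [IsAlgClosure K L]
    (E : WeierstrassCurve K) [E.IsElliptic] (hCM : QuadQCurve.IsNonCM L E)
    (d : ℕ) (hd : Odd d) (hQ : QuadQCurve.IsQCurveOfDegree L E d)
    (h4 : QuadQCurve.HasCyclicIsogeny L E 4) :
    ∃ (F : WeierstrassCurve K) (_ : F.IsElliptic), (F = E ∨ QuadQCurve.IsogenousOver L E F) ∧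
      (QuadQCurve.CorrespondsToRationalPointPlus L F (4 * d) ∨
        QuadQCurve.CorrespondsToRationalPointPlus L F (16 * d) ∨
        QuadQCurve.CorrespondsToRationalPoint L F (4 * d) d) := by
  obtain h | ⟨m, hm, hm1, F, hF, hEF, h⟩ :=
    mainTheorem6_general hK E hCM d 4 (hd.coprime_two_right.pow_right 2) hQ h4
  · exact ⟨E, inferInstance, .inl rfl, .inr (.inr h)⟩
  · obtain rfl | rfl : m = 2 ∨ m = 4 := by
      have := Nat.le_of_dvd four_pos hm
      interval_cases m <;> omega
    exacts [⟨F, hF, .inr hEF, .inl h⟩, ⟨F, hF, .inr hEF, .inr (.inl h)⟩]
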